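/- Graphs are finite, nonnull and loopless, and multiple edges are allowed. $d_G(v)$ is the number of edges of $G$ incident to $v$. A graph is $k$-edge-connected if for every nonempty proper subset $S$ of its vertex set at least $k$ edges have exactly one end in $S$, and it is $m$-tree-connected if it contains $m$ pairwise edge-disjoint spanning trees. A vertex set is independent if no edge joins two of its vertices. Theorem. Let $m,k$ be positive integers, let $G$ be a graph and let $X\subseteq V(G)$. (1) If $G$ is $k$-edge-connected and $k\ge 2m$, then $G$ has an $m$-tree-connected spanning subgraph $H$ such that $d_H(v)\le\left\lceil\frac{m}{k}(d_G(v)-2m)\right\rceil+2m$ for each $v\in X$. (2) If $G$ is $k$-tree-connected and $k\ge m$, then $G$ has an $m$-tree-connected spanning subgraph $H$ such that $d_H(v)\le\left\lceil\frac{m}{k}(d_G(v)-m)\right\rceil+m$ for each $v\in X$. (3) If $G$ is $k$-edge-connected, $k\ge 2m$ and $X$ is independent, then $G$ has an $m$-tree-connected spanning subgraph $H$ such that $d_H(v)\le\left\lceil\frac{m}{k}d_G(v)\right\rceil+m$ for each $v\in X$. (4) If $G$ is $k$-tree-connected, $k\ge m$ and $X$ is independent, then $G$ has an $m$-tree-connected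 spanning subgraph $H$ such that $d_H(v)\le\left\lceil\frac{m}{k}d_G(v)\right\rceil$ for each $v\in X$. Furthermore, in each of the four cases, for any given vertex $u\in V(G)$ the subgraph $H$ can be chosen so that in addition $d_H(u)\le\left\lfloor\frac{m}{k}d_G(u)\right\rfloor$. -/

import Mathlib

/-! Multigraphs are Mathlib's `Graph α β`: a vertex set in `α`, an edge set in `β`, parallel edges
allowed. The definitions of degree and edge cut below count every edge once; they are used for
loopless graphs only. -/

namespace Graph

variable {α β : Type*}

/-- The degree of `v`: the number of edges of `G` incident to `v` (for a loopless finite `G`). -/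
noncomputable def deg (G : Graph α β) (v : α) : ℕ := (G.incidenceSet v).ncard

/-- The set of edges of `G` with exactly one end in `S`. -/
def cut (G : Graph α β) (S : Set α) : Set β := {e | ∃ x ∈ S, ∃ y ∉ S, G.IsLink e x y}

/-- `G` is `k`-edge-connected: it is nonnull, and every nonempty proper subset of its vertex set is
left by at least `k` edges. -/
def IsEdgeConnected (G : Graph α β) (k : ℕ) : Prop :=
  G.vertexSet.Nonempty ∧
    ∀ S : Set α, S ⊆ G.vertexSet → S.Nonempty → S ≠ G.vertexSet → k ≤ (G.cut S).ncard

/-- `G` is connected: it is nonnull, and any two of its vertices are joined by a walk. -/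
def IsConnected (G : Graph α β) : Prop :=
  G.vertexSet.Nonempty ∧
    ∀ x ∈ G.vertexSet, ∀ y ∈ G.vertexSet, Relation.ReflTransGen G.Adj x y

/-- `G` contains a cycle of length `n + 1`: distinct vertices `v 0, …, v n` and distinct edges
`e 0, …, e n` such that `e i` joins `v i` and `v (i + 1)`, where `i + 1` is taken cyclically.
A loop is a cycle of length one and a pair of parallel edges is a cycle of length two. -/
def HasCycle (G : Graph α β) : Prop :=
  ∃ (n : ℕ) (v : Fin (n + 1) → α) (e : Fin (n + 1) → β),
    Function.Injective v ∧ Function.Injective e ∧ ∀ i, G.IsLink (e i) (v i) (v (i + 1))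

/-- A tree is a connected graph without cycles. -/
def IsTree (G : Graph α β) : Prop := G.IsConnected ∧ ¬ G.HasCycle

/-- `G` is `m`-tree-connected: it has `m` pairwise edge-disjoint spanning trees. -/
def IsTreeConnected (G : Graph α β) (m : ℕ) : Prop :=
  ∃ T : Fin m → Graph α β, (∀ i, (T i).IsSpanningSubgraph G ∧ (T i).IsTree) ∧
    ∀ i j, i ≠ j → Disjoint (T i).edgeSet (T j).edgeSet

/-- `X` is independent in `G`: no edge of `G` joins two vertices of `X`. -/
def IsIndependent (G : Graph α β) (X : Set α) : Prop := ∀ x ∈ X, ∀ y ∈ X, ¬ G.Adj x y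

end Graph

/-!
An edge set that is a disjoint union of `m` spanning trees is the same as an integral point of the
polytope of all `x ∈ [0, 1]^E` that put weight at most `m (|A| - 1)` inside every nonempty vertex
set `A`, with equality for the whole vertex set. Each hypothesis provides a fractional point `z` of
this polytope with small weight on the edges touching any given set `S`. If `G` is
`k`-tree-connected, scale `k` disjoint spanning trees by `m / k`. If `G` is `k`-edge-connected,
replace every edge by two opposite arcs of weight `m / k`, so that weight at least `m` enters every
nonempty set avoiding the root `u`. Decrease the weights to a minimal vector with this property:
every vertex other than `u` then receives exactly `m`, and forgetting directions gives `z`.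

For independent `X`, the fractional coordinates of an extreme point of the polytope cut by integral
degree bounds on `X` split into classes with respect to the tight sets, and the stars of the
vertices of `X` are disjoint. Two disjoint families of sets, none a singleton, never suffice to make
the point extreme, so extreme points are integral. The same argument applied to the two sides of
`x + (χ - x) = χ` splits a base `χ` into trees.

For general `X`, take a base `H` of least total excess over the degree bounds. If some bound is
violated, then local exchanges yield a set `S` of vertices, all saturated and one of them overfull,
such that `H` has as few edges touching `S` as any base. Comparing with the weight of `z` on these
edges gives a contradiction.
-/

open Finset Topology

section ExtremePoints

lemma eventually_add_mul_le {a b c : ℝ} (hab : a ≤ b) (h : a = b → c = 0) :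
    ∀ᶠ r in 𝓝 (0 : ℝ), a + r * c ≤ b := by
  rcases hab.eq_or_lt with rfl | hlt
  · simp [h rfl]
  · have hcont : Filter.Tendsto (fun r : ℝ => a + r * c) (𝓝 0) (𝓝 (a + 0 * c)) :=
      (by fun_prop : Continuous fun r : ℝ => a + r * c).tendsto 0
    rw [zero_mul, add_zero] at hcont
    exact (hcont.eventually_lt_const hlt).mono fun _ => le_of_lt

lemma eq_zero_of_mem_extremePoints {F : Type*} [AddCommGroup F] [Module ℝ F] {Q : Set F} {x y : F}
    (hx : x ∈ Q.extremePoints ℝ) (h : ∀ᶠ r : ℝ in 𝓝 0, x + r • y ∈ Q) : y = 0 := by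
  obtain ⟨ε, hε, hball⟩ := Metric.eventually_nhds_iff.1 h
  have hpos : x + (ε / 2) • y ∈ Q := hball (by
    rw [Real.dist_0_eq_abs, abs_of_pos (half_pos hε)]
    exact half_lt_self hε)
  have hneg : x + (-(ε / 2)) • y ∈ Q := hball (by
    rw [Real.dist_0_eq_abs, abs_neg, abs_of_pos (half_pos hε)]
    exact half_lt_self hε)
  have hseg : x ∈ openSegment ℝ (x + (ε / 2) • y) (x + (-(ε / 2)) • y) :=
    ⟨1 / 2, 1 / 2, by norm_num, by norm_num, by norm_num, by module⟩
  have heq := (mem_extremePoints.1 hx).2 _ hpos _ hneg hseg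
  exact (smul_eq_zero.1 (add_eq_left.1 heq.1)).resolve_left (half_pos hε).ne'

lemma exists_mem_extremePoints_le {F : Type*} [AddCommGroup F] [Module ℝ F] [TopologicalSpace F]
    [T2Space F] [IsTopologicalAddGroup F] [ContinuousSMul ℝ F] [LocallyConvexSpace ℝ F]
    {Q : Set F} (hQ : IsCompact Q) {z : F} (hz : z ∈ Q) (f : StrongDual ℝ F) :
    ∃ x ∈ Q.extremePoints ℝ, f x ≤ f z := by
  obtain ⟨x₀, hx₀, hmin⟩ := hQ.exists_isMinOn ⟨z, hz⟩ f.continuous.continuousOn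
  have hface : IsExposed ℝ Q ((-f).toExposed Q) := ContinuousLinearMap.toExposed.isExposed
  have hne : ((-f).toExposed Q).Nonempty :=
    ⟨x₀, hx₀, fun y hy => neg_le_neg (isMinOn_iff.1 hmin y hy)⟩
  obtain ⟨x, hx⟩ := (hface.isCompact hQ).extremePoints_nonempty hne
  exact ⟨x, hface.isExtreme.extremePoints_subset_extremePoints hx, neg_le_neg_iff.1 (hx.1.2 z hz)⟩

lemma two_mul_card_le_card_biUnion {E ι : Type*} [Fintype ι] [DecidableEq E] {A : ι → Finset E}
    (hA : Pairwise fun i j => Disjoint (A i) (A j)) (hA₂ : ∀ i, 2 ≤ #(A i)) :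
    2 * Fintype.card ι ≤ #(univ.biUnion A) := by
  rw [card_biUnion fun i _ j _ hij => hA hij, mul_comm, Fintype.card, ← smul_eq_mul]
  exact card_nsmul_le_sum _ _ _ fun i _ => hA₂ i

section Families

variable {E ι κ : Type*} [Finite ι] [Finite κ] {S : Finset E} {A : ι → Finset E}
  {B : κ → Finset E}

lemma exists_ne_zero_or_forall_exists_sum_eq {γ : Type*} [Fintype γ] [Fintype E] (C : γ → Finset E)
    (h : Fintype.card γ ≤ Fintype.card E) :
    (∃ y : E → ℝ, y ≠ 0 ∧ ∀ c, ∑ e ∈ C c, y e = 0) ∨ (Fintype.card γ = Fintype.card E ∧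
      ∀ b : γ → ℝ, ∃ y : E → ℝ, ∀ c, ∑ e ∈ C c, y e = b c) := by
  let L : (E → ℝ) →ₗ[ℝ] (γ → ℝ) := LinearMap.pi fun c => ∑ e ∈ C c, LinearMap.proj e
  have hL (y : E → ℝ) (c : γ) : L y c = ∑ e ∈ C c, y e := by simp [L]
  by_cases hinj : Function.Injective L
  · have hdim := LinearMap.finrank_le_finrank_of_injective hinj
    simp only [Module.finrank_fintype_fun_eq_card] at hdim
    have hcard := h.antisymm hdim
    have hsurj := (LinearMap.injective_iff_surjective_of_finrank_eq_finrank
      (by simpa only [Module.finrank_fintype_fun_eq_card] using hcard.symm)).1 hinj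
    refine .inr ⟨hcard, fun b => ?_⟩
    obtain ⟨y, rfl⟩ := hsurj b
    exact ⟨y, fun c => (hL y c).symm⟩
  · rw [injective_iff_map_eq_zero] at hinj
    push Not at hinj
    obtain ⟨y, hy, hy0⟩ := hinj
    exact .inl ⟨y, hy0, fun c => by rw [← hL, hy, Pi.zero_apply]⟩

/-- Were the linear conditions independent, both families would partition `S` into pairs, and then
the total over `S` could be computed in two incompatible ways. -/
lemma exists_ne_zero_sum_eq_zero_of_two_le_card [Finite E] (hS : S.Nonempty)
    (hA : Pairwise fun i j => Disjoint (A i) (A j)) (hB : Pairwise fun i j => Disjoint (B i) (B j))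
    (hAS : ∀ i, A i ⊆ S) (hBS : ∀ j, B j ⊆ S) (hA₂ : ∀ i, 2 ≤ #(A i)) (hB₂ : ∀ j, 2 ≤ #(B j)) :
    ∃ y : E → ℝ, y ≠ 0 ∧ (∀ e ∉ S, y e = 0) ∧ (∀ i, ∑ e ∈ A i, y e = 0) ∧
      ∀ j, ∑ e ∈ B j, y e = 0 := by
  classical
  have := Fintype.ofFinite E
  have := Fintype.ofFinite ι
  have := Fintype.ofFinite κ
  have hcA := two_mul_card_le_card_biUnion hA hA₂
  have hcB := two_mul_card_le_card_biUnion hB hB₂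
  have hsubA : univ.biUnion A ⊆ S := biUnion_subset.2 fun i _ => hAS i
  have hsubB : univ.biUnion B ⊆ S := biUnion_subset.2 fun j _ => hBS j
  have hleA := card_le_card hsubA
  have hleB := card_le_card hsubB
  have hSE := card_le_univ S
  have hcS := Fintype.card_subtype_compl (· ∈ S)
  rw [Fintype.card_coe] at hcS
  obtain ⟨y, hy0, hy⟩ | ⟨hcard, hsurj⟩ := exists_ne_zero_or_forall_exists_sum_eq
    (γ := ι ⊕ κ ⊕ {e // e ∉ S}) (Sum.elim A (Sum.elim B fun e => {e.1}))
    (by simp only [Fintype.card_sum]; omega)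
  · exact ⟨y, hy0, fun e he => by simpa using hy (.inr (.inr ⟨e, he⟩)),
      fun i => hy (.inl i), fun j => hy (.inr (.inl j))⟩
  exfalso
  simp only [Fintype.card_sum] at hcard
  have hUA : univ.biUnion A = S := eq_of_subset_of_card_le hsubA (by omega)
  have hUB : univ.biUnion B = S := eq_of_subset_of_card_le hsubB (by omega)
  have hSpos := hS.card_pos
  obtain ⟨i₀⟩ : Nonempty ι := Fintype.card_pos_iff.1 (by omega)
  obtain ⟨y, hy⟩ := hsurj (Pi.single (.inl i₀) 1)
  have hsumA : ∑ e ∈ S, y e = 1 := by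
    rw [← hUA, sum_biUnion fun i _ j _ hij => hA hij]
    exact (sum_congr rfl fun i _ => hy (.inl i)).trans (by simp [Pi.single_apply])
  have hsumB : ∑ e ∈ S, y e = 0 := by
    rw [← hUB, sum_biUnion fun i _ j _ hij => hB hij]
    exact (sum_congr rfl fun j _ => hy (.inr (.inl j))).trans (by simp)
  exact one_ne_zero (hsumA.symm.trans hsumB)

lemma exists_ne_zero_sum_eq_zero [Finite E] (hS : S.Nonempty)
    (hA : Pairwise fun i j => Disjoint (A i) (A j)) (hB : Pairwise fun i j => Disjoint (B i) (B j))
    (hAS : ∀ i, A i ⊆ S) (hBS : ∀ j, B j ⊆ S) (hA₁ : ∀ i, #(A i) ≠ 1) (hB₁ : ∀ j, #(B j) ≠ 1) :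
    ∃ y : E → ℝ, y ≠ 0 ∧ (∀ e ∉ S, y e = 0) ∧ (∀ i, ∑ e ∈ A i, y e = 0) ∧
      ∀ j, ∑ e ∈ B j, y e = 0 := by
  classical
  have htwo {n : ℕ} (h0 : 0 < n) (h1 : n ≠ 1) : 2 ≤ n := by omega
  obtain ⟨y, hy, hyS, hyA, hyB⟩ := exists_ne_zero_sum_eq_zero_of_two_le_card hS
    (A := fun i : {i // (A i).Nonempty} => A i) (B := fun j : {j // (B j).Nonempty} => B j)
    (fun i j hij => hA (Subtype.coe_ne_coe.2 hij)) (fun i j hij => hB (Subtype.coe_ne_coe.2 hij))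
    (fun i => hAS i) (fun j => hBS j) (fun i => htwo i.2.card_pos (hA₁ i))
    fun j => htwo j.2.card_pos (hB₁ j)
  refine ⟨y, hy, hyS, fun i => ?_, fun j => ?_⟩
  · rcases (A i).eq_empty_or_nonempty with h | h
    exacts [by rw [h, sum_empty], hyA ⟨i, h⟩]
  · rcases (B j).eq_empty_or_nonempty with h | h
    exacts [by rw [h, sum_empty], hyB ⟨j, h⟩]

lemma eq_empty_of_mem_extremePoints [Finite E] {Q : Set (E → ℝ)} {x : E → ℝ}
    (hx : x ∈ Q.extremePoints ℝ)
    (hA : Pairwise fun i j => Disjoint (A i) (A j)) (hB : Pairwise fun i j => Disjoint (B i) (B j))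
    (hAS : ∀ i, A i ⊆ S) (hBS : ∀ j, B j ⊆ S) (hA₁ : ∀ i, #(A i) ≠ 1) (hB₁ : ∀ j, #(B j) ≠ 1)
    (h : ∀ y : E → ℝ, (∀ e ∉ S, y e = 0) → (∀ i, ∑ e ∈ A i, y e = 0) →
      (∀ j, ∑ e ∈ B j, y e = 0) → ∀ᶠ r : ℝ in 𝓝 0, x + r • y ∈ Q) : S = ∅ := by
  by_contra hS
  obtain ⟨y, hy, hyS, hyA, hyB⟩ := exists_ne_zero_sum_eq_zero (nonempty_iff_ne_empty.2 hS)
    hA hB hAS hBS hA₁ hB₁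
  exact hy (eq_zero_of_mem_extremePoints hx (h y hyS hyA hyB))

end Families

end ExtremePoints

/-- A multigraph whose edge `e` joins `tail e` and `head e`. Most notions below ignore the reference
orientation, which is a way of naming the two ends of an edge; `entering` uses it. -/
structure OrientedMultigraph (V E : Type*) where
  tail : E → V
  head : E → V

namespace OrientedMultigraph

variable {V E : Type*} [Fintype E] [DecidableEq V] (D : OrientedMultigraph V E)

/-- The edges with both ends in `A`. -/
def inside (A : Finset V) : Finset E := {e | D.tail e ∈ A ∧ D.head e ∈ A}

/-- The edges incident to `v`. -/
def star (v : V) : Finset E := {e | D.tail e = v ∨ D.head e = v}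

/-- The characteristic vector of an edge set. -/
noncomputable def charVec {E : Type*} (H : Finset E) : E → ℝ := (H : Set E).indicator 1

/-- Fractional relaxation of being a union of `m` forests: every nonempty vertex set `A`
carries weight at most `m * (|A| - 1)`. -/
def IsSparse (m : ℕ) (x : E → ℝ) : Prop :=
  ∀ A : Finset V, A.Nonempty → ∑ e ∈ D.inside A, x e ≤ m * ((#A : ℝ) - 1)

/-- The vertex sets at which the sparsity condition holds with equality. -/
def IsTight (m : ℕ) (x : E → ℝ) (A : Finset V) : Prop :=
  A.Nonempty ∧ ∑ e ∈ D.inside A, x e = m * ((#A : ℝ) - 1)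

/-- A point of the base polytope of the `m`-fold union of the graphic matroid. -/
structure IsFracBase [Fintype V] (m : ℕ) (x : E → ℝ) : Prop where
  nonneg : ∀ e, 0 ≤ x e
  le_one : ∀ e, x e ≤ 1
  isSparse : D.IsSparse m x
  isTight_univ : D.IsTight m x univ

/-- An integral point of the base polytope; as a set of edges it is the union of `m` edge-disjoint
spanning trees, see `IsBase.exists_disjoint_trees`. -/
def IsBase [Fintype V] (m : ℕ) (H : Finset E) : Prop := D.IsFracBase m (charVec H)

variable {D} {m : ℕ} {x y z : E → ℝ} {A B U : Finset V} {H K : Finset E} {e f : E} {v w : V}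

@[simp] lemma mem_inside : e ∈ D.inside A ↔ D.tail e ∈ A ∧ D.head e ∈ A := by simp [inside]

@[simp] lemma mem_star : e ∈ D.star v ↔ D.tail e = v ∨ D.head e = v := by simp [star]

@[simp] lemma inside_univ [Fintype V] : D.inside univ = univ := by ext; simp

@[simp] lemma inside_empty : D.inside ∅ = ∅ := by ext; simp

lemma inside_mono (h : A ⊆ B) : D.inside A ⊆ D.inside B := fun e he => by
  rw [mem_inside] at *
  exact ⟨h he.1, h he.2⟩

lemma inside_inter [DecidableEq E] (A B : Finset V) :
    D.inside (A ∩ B) = D.inside A ∩ D.inside B := by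
  ext
  simp only [mem_inter, mem_inside]
  tauto

section CharVec

variable {E : Type*} {H K : Finset E} {e f : E}

lemma charVec_of_mem (h : e ∈ H) : charVec H e = 1 := Set.indicator_of_mem (mem_coe.2 h) 1

lemma charVec_of_notMem (h : e ∉ H) : charVec H e = 0 :=
  Set.indicator_of_notMem (mt mem_coe.1 h) 1

lemma charVec_nonneg (H : Finset E) (e : E) : 0 ≤ charVec H e :=
  Set.indicator_nonneg (fun _ _ => zero_le_one) e

lemma charVec_le_one (H : Finset E) (e : E) : charVec H e ≤ 1 :=
  Set.indicator_le_self' (fun _ _ => zero_le_one) e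

lemma charVec_congr (h : e ∈ H ↔ f ∈ K) : charVec H e = charVec K f := by
  by_cases he : e ∈ H
  · rw [charVec_of_mem he, charVec_of_mem (h.1 he)]
  · rw [charVec_of_notMem he, charVec_of_notMem (mt h.2 he)]

lemma sum_charVec [DecidableEq E] (H S : Finset E) : ∑ e ∈ S, charVec H e = #(H ∩ S) := by
  simp [charVec, Set.indicator_apply, inter_comm]

lemma sum_charVec_biUnion {ι : Type*} [Fintype ι] [DecidableEq E] {T : ι → Finset E}
    (hT : Pairwise fun i j => Disjoint (T i) (T j)) (S : Finset E) :
    ∑ e ∈ S, charVec (univ.biUnion T) e = ∑ i, ∑ e ∈ S, charVec (T i) e := by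
  simp only [sum_charVec, biUnion_inter]
  rw [card_biUnion fun i _ j _ hij => (hT hij).mono inter_subset_left inter_subset_left]
  push_cast
  rfl

end CharVec

/-! ### Uncrossing -/

lemma sum_inside_union_add_sum_inside_inter [DecidableEq E] (x : E → ℝ) (A B : Finset V) :
    ∑ e ∈ D.inside (A ∪ B), x e + ∑ e ∈ D.inside (A ∩ B), x e =
      ∑ e ∈ D.inside A, x e + ∑ e ∈ D.inside B, x e +
        ∑ e ∈ D.inside (A ∪ B) \ (D.inside A ∪ D.inside B), x e := by
  have hsub : D.inside A ∪ D.inside B ⊆ D.inside (A ∪ B) :=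
    union_subset (inside_mono subset_union_left) (inside_mono subset_union_right)
  rw [← sum_sdiff hsub, inside_inter, add_assoc, sum_union_inter, add_comm]

lemma mul_card_sub_one_union_add_inter (m : ℝ) (A B : Finset V) :
    m * ((#(A ∪ B) : ℝ) - 1) + m * ((#(A ∩ B) : ℝ) - 1) =
      m * ((#A : ℝ) - 1) + m * ((#B : ℝ) - 1) := by
  have h : (#(A ∪ B) : ℝ) + #(A ∩ B) = #A + #B := by exact_mod_cast card_union_add_card_inter A B
  linear_combination m * h

section Uncross

variable (hs : D.IsSparse m x) (hx : ∀ e, 0 ≤ x e) (hA : D.IsTight m x A) (hB : D.IsTight m x B)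
  (hAB : (A ∩ B).Nonempty)

include hs hx hA hB hAB

lemma IsTight.union_and_inter : D.IsTight m x (A ∪ B) ∧ D.IsTight m x (A ∩ B) := by
  classical
  have hU : (A ∪ B).Nonempty := hA.1.mono subset_union_left
  have hsum := D.sum_inside_union_add_sum_inside_inter x A B
  have hcard := mul_card_sub_one_union_add_inter (m : ℝ) A B
  have hnonneg : 0 ≤ ∑ e ∈ D.inside (A ∪ B) \ (D.inside A ∪ D.inside B), x e :=
    sum_nonneg fun e _ => hx e
  have hunion := hs _ hU
  have hinter := hs _ hAB
  exact ⟨⟨hU, by linarith [hA.2, hB.2]⟩, ⟨hAB, by linarith [hA.2, hB.2]⟩⟩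

lemma IsTight.union : D.IsTight m x (A ∪ B) := (hA.union_and_inter hs hx hB hAB).1

lemma IsTight.inter : D.IsTight m x (A ∩ B) := (hA.union_and_inter hs hx hB hAB).2

lemma IsTight.mem_inside_of_mem_inside_union (he : e ∈ D.inside (A ∪ B)) (hpos : 0 < x e) :
    e ∈ D.inside A ∨ e ∈ D.inside B := by
  classical
  by_contra hcon
  have hmem : e ∈ D.inside (A ∪ B) \ (D.inside A ∪ D.inside B) :=
    mem_sdiff.2 ⟨he, fun h => hcon (mem_union.1 h)⟩
  have hsum := D.sum_inside_union_add_sum_inside_inter x A B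
  have hcard := mul_card_sub_one_union_add_inter (m : ℝ) A B
  linarith [single_le_sum (f := x) (fun i _ => hx i) hmem, hA.2, hB.2,
    (hA.union hs hx hB hAB).2, (hA.inter hs hx hB hAB).2]

end Uncross

/-! ### Sparse edge sets -/

/-- The edges lying inside some vertex set with property `P`. -/
noncomputable def covered (D : OrientedMultigraph V E) (P : Finset V → Prop) : Finset E := by
  classical exact {e | ∃ A, P A ∧ e ∈ D.inside A}

@[simp] lemma mem_covered {P : Finset V → Prop} :
    e ∈ D.covered P ↔ ∃ A, P A ∧ e ∈ D.inside A := by simp [covered]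

/-- The maximal members of a family closed under unions of intersecting members partition the edges
covered by the family. -/
lemma exists_sum_covered_eq_sum [Finite V] (P : Finset V → Prop)
    (hP : ∀ A B, P A → P B → (A ∩ B).Nonempty → P (A ∪ B)) :
    ∃ 𝓜 : Finset (Finset V), (∀ A ∈ 𝓜, P A) ∧
      ∀ g : E → ℝ, ∑ e ∈ D.covered P, g e = ∑ A ∈ 𝓜, ∑ e ∈ D.inside A, g e := by
  classical
  have := Fintype.ofFinite V
  refine ⟨({A | Maximal P A} : Finset (Finset V)), fun A hA => (mem_filter.1 hA).2.1, fun g => ?_⟩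
  rw [← sum_biUnion fun A hA B hB hne => ?_]
  · refine sum_congr (ext fun e => ?_) fun _ _ => rfl
    simp only [mem_covered, mem_biUnion, mem_filter, mem_univ, true_and]
    constructor
    · rintro ⟨A, hA, he⟩
      obtain ⟨B, hAB, hB⟩ := ({A | P A} : Finset (Finset V)).exists_le_maximal (by simpa using hA)
      exact ⟨B, by simpa using hB, inside_mono hAB he⟩
    · rintro ⟨A, hA, he⟩
      exact ⟨A, hA.1, he⟩
  · rw [mem_coe, mem_filter] at hA hB
    refine disjoint_left.2 fun e heA heB => hne ?_
    have hAB := hP A B hA.2.1 hB.2.1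
      ⟨D.tail e, mem_inter.2 ⟨(mem_inside.1 heA).1, (mem_inside.1 heB).1⟩⟩
    exact (hA.2.eq_of_le hAB subset_union_left).trans
      (hB.2.eq_of_le hAB subset_union_right).symm

lemma IsSparse.mono (hy : D.IsSparse m y) (h : ∀ e, x e ≤ y e) : D.IsSparse m x :=
  fun A hA => (sum_le_sum fun e _ => h e).trans (hy A hA)

lemma isSparse_zero (m : ℕ) : D.IsSparse m 0 := fun A hA => by
  have : (1 : ℝ) ≤ #A := by exact_mod_cast hA.card_pos
  simpa using mul_nonneg m.cast_nonneg (sub_nonneg.2 this)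

lemma IsSparse.isTight_singleton (hs : D.IsSparse m x) (hx : ∀ e, 0 ≤ x e) (v : V) :
    D.IsTight m x {v} :=
  ⟨singleton_nonempty v, (hs _ (singleton_nonempty v)).antisymm <| by
    simpa using sum_nonneg fun e _ => hx e⟩

lemma sum_inside_le_sum_charVec [Finite V] (hz : D.IsSparse m z) (hz₁ : ∀ e, z e ≤ 1)
    (hH : D.IsSparse m (charVec H)) (U : Finset V)
    (h : ∀ e ∈ D.inside U, e ∉ H → ∃ A ⊆ U, D.IsTight m (charVec H) A ∧ e ∈ D.inside A) :
    ∑ e ∈ D.inside U, z e ≤ ∑ e ∈ D.inside U, charVec H e := by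
  classical
  let P : Finset V → Prop := fun A => A ⊆ U ∧ D.IsTight m (charVec H) A
  obtain ⟨𝓜, hM, hsum⟩ := D.exists_sum_covered_eq_sum P fun A B hA hB hAB =>
    ⟨union_subset hA.1 hB.1, hA.2.union hH (charVec_nonneg H) hB.2 hAB⟩
  have hsub : D.covered P ⊆ D.inside U := fun e he => by
    obtain ⟨A, hA, he⟩ := mem_covered.1 he
    exact inside_mono hA.1 he
  rw [← sum_sdiff hsub, ← sum_sdiff hsub (f := charVec H), hsum, hsum]
  refine add_le_add (sum_le_sum fun e he => ?_) (sum_le_sum fun A hA => ?_)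
  · rw [mem_sdiff, mem_covered] at he
    have heH : e ∈ H := by
      by_contra heH
      obtain ⟨A, hAU, hA, heA⟩ := h e he.1 heH
      exact he.2 ⟨A, ⟨hAU, hA⟩, heA⟩
    rw [charVec_of_mem heH]
    exact hz₁ e
  · rw [(hM A hA).2.2]
    exact hz A (hM A hA).2.1

/-- A sparse edge set can only stop being sparse at one of its tight sets. -/
lemma IsSparse.exchange [DecidableEq E] (hH : D.IsSparse m (charVec H)) (hK : K ⊆ insert e H)
    (h : ∀ A, D.IsTight m (charVec H) A → e ∈ D.inside A → ∃ f ∈ D.inside A, f ∈ H ∧ f ∉ K) :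
    D.IsSparse m (charVec K) := by
  intro A hA
  have hHA := hH A hA
  rw [sum_charVec] at hHA ⊢
  have hsub : K ∩ D.inside A ⊆ insert e (H ∩ D.inside A) := fun g hg => by
    have := hK (mem_inter.1 hg).1
    simp only [mem_insert, mem_inter] at *
    tauto
  by_cases hT : D.IsTight m (charVec H) A
  · refine le_trans ?_ hHA
    norm_cast
    by_cases he : e ∈ D.inside A
    · obtain ⟨f, hfA, hfH, hfK⟩ := h A hT he
      have hsub' : K ∩ D.inside A ⊆ (insert e (H ∩ D.inside A)).erase f :=
        subset_erase.2 ⟨hsub, fun hf => hfK (mem_inter.1 hf).1⟩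
      have hf : f ∈ insert e (H ∩ D.inside A) := mem_insert_of_mem (mem_inter.2 ⟨hfH, hfA⟩)
      have := card_le_card hsub'
      have := card_erase_add_one hf
      have := card_insert_le e (H ∩ D.inside A)
      omega
    · exact card_le_card <| (subset_insert_iff_of_notMem fun h => he (mem_inter.1 h).2).1 hsub
  · have hlt : (#(H ∩ D.inside A) : ℝ) < m * (#A - 1) :=
      hHA.lt_of_ne fun h => hT ⟨hA, by rw [sum_charVec, h]⟩
    have hlt' : (#(H ∩ D.inside A) : ℤ) < m * (#A - 1) := by exact_mod_cast hlt
    have hcard : (#(K ∩ D.inside A) : ℤ) ≤ m * (#A - 1) := by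
      have := (card_le_card hsub).trans (card_insert_le _ _)
      omega
    exact_mod_cast hcard

lemma exists_maximal_isSparse (D : OrientedMultigraph V E) (m : ℕ) (S : Finset E) :
    ∃ H ⊆ S, D.IsSparse m (charVec H) ∧
      ∀ e ∈ S, e ∉ H → ∃ A, D.IsTight m (charVec H) A ∧ e ∈ D.inside A := by
  classical
  obtain ⟨H, -, hH⟩ := ({H ∈ S.powerset | D.IsSparse m (charVec H)}).exists_le_maximal
    (a := ∅) (by
      simp only [mem_filter, empty_mem_powerset, true_and]
      exact (isSparse_zero m).mono fun e => (charVec_of_notMem (notMem_empty e)).le)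
  obtain ⟨hHS, hHs⟩ := mem_filter.1 hH.1
  rw [mem_powerset] at hHS
  refine ⟨H, hHS, hHs, fun e he heH => ?_⟩
  by_contra! hcon
  have hins : insert e H ∈ S.powerset.filter fun H => D.IsSparse m (charVec H) :=
    mem_filter.2 ⟨mem_powerset.2 (insert_subset he hHS),
      hHs.exchange subset_rfl fun A hA heA => absurd heA (hcon A hA)⟩
  exact heH (insert_eq_self.1 (hH.eq_of_le hins (subset_insert e H)).symm)

lemma IsFracBase.exists_isBase [Fintype V] (hz : D.IsFracBase m z) : ∃ H, D.IsBase m H := by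
  obtain ⟨H, -, hs, hmax⟩ := D.exists_maximal_isSparse m univ
  have hU := hz.isTight_univ.1
  refine ⟨H, charVec_nonneg H, charVec_le_one H, hs, hU, (hs _ hU).antisymm ?_⟩
  rw [← hz.isTight_univ.2]
  refine sum_inside_le_sum_charVec hz.isSparse hz.le_one hs _ fun e _ he => ?_
  obtain ⟨A, hA, heA⟩ := hmax e (mem_univ e) he
  exact ⟨A, subset_univ _, hA, heA⟩

lemma IsFracBase.exists_least_isTight [Fintype V] (hx : D.IsFracBase m x) (e : E) :
    ∃ T, D.IsTight m x T ∧ e ∈ D.inside T ∧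
      ∀ B, D.IsTight m x B → e ∈ D.inside B → T ⊆ B := by
  classical
  obtain ⟨T, hT, hmin⟩ := exists_min_image ({T | D.IsTight m x T ∧ e ∈ D.inside T}) card
    ⟨univ, by simpa using hx.isTight_univ⟩
  obtain ⟨-, hTt, heT⟩ := mem_filter.1 hT
  refine ⟨T, hTt, heT, fun B hB heB => ?_⟩
  have he : e ∈ D.inside (T ∩ B) := by
    rw [inside_inter]
    exact mem_inter.2 ⟨heT, heB⟩
  have htight := hTt.inter hx.isSparse hx.nonneg hB ⟨_, (mem_inside.1 he).1⟩
  exact inter_eq_left.1 <| eq_of_subset_of_card_le inter_subset_left <|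
    hmin _ (mem_filter.2 ⟨mem_univ _, htight, he⟩)

/-! ### Local changes of a base -/

/-- The degree of `v` in the edge set `H`. -/
def degree {E : Type*} (D : OrientedMultigraph V E) (H : Finset E) (v : V) : ℕ :=
  #{e ∈ H | D.tail e = v ∨ D.head e = v}

/-- The edge sets `K` and `H` differ only inside `A`. -/
def AgreesOff (D : OrientedMultigraph V E) (A : Finset V) (K H : Finset E) : Prop :=
  ∀ e ∉ D.inside A, e ∈ K ↔ e ∈ H

lemma notMem_inside_of_mem_star (hv : v ∉ A) (he : e ∈ D.star v) : e ∉ D.inside A := by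
  rw [mem_inside]
  rintro ⟨ht, hh⟩
  rcases mem_star.1 he with rfl | rfl
  exacts [hv ht, hv hh]

lemma notMem_inside_of_disjoint (hAB : Disjoint A B) (he : e ∈ D.inside A) : e ∉ D.inside B :=
  fun h => disjoint_left.1 hAB (mem_inside.1 he).1 (mem_inside.1 h).1

lemma cast_degree (D : OrientedMultigraph V E) (H : Finset E) (v : V) :
    (D.degree H v : ℝ) = ∑ e ∈ D.star v, charVec H e := by
  classical
  rw [sum_charVec, degree]
  congr 2
  ext e
  simp

lemma degree_insert_erase [DecidableEq E] (he : e ∉ H) (hf : f ∈ H) (v : V) :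
    D.degree ((insert e H).erase f) v + (if f ∈ D.star v then 1 else 0) =
      D.degree H v + (if e ∈ D.star v then 1 else 0) := by
  simp only [degree, card_filter, mem_star]
  rw [sum_erase_add _ _ (mem_insert_of_mem hf), sum_insert he, add_comm]

lemma AgreesOff.degree_eq (h : D.AgreesOff A K H) (hv : v ∉ A) : D.degree K v = D.degree H v := by
  refine congrArg card (ext fun e => ?_)
  simp only [mem_filter, and_congr_left_iff]
  exact fun he => h e (notMem_inside_of_mem_star hv (mem_star.2 he))

lemma sum_inside_add_sum_inside_inter_of_eq_off (h : ∀ e ∉ D.inside A, y e = x e) (B : Finset V) :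
    ∑ e ∈ D.inside B, y e + ∑ e ∈ D.inside (A ∩ B), x e =
      ∑ e ∈ D.inside B, x e + ∑ e ∈ D.inside (A ∩ B), y e := by
  classical
  have hsub : D.inside (A ∩ B) ⊆ D.inside B := inside_mono inter_subset_right
  rw [← sum_sdiff hsub, ← sum_sdiff hsub (f := x), sum_congr rfl fun e he => h e fun heA => ?_]
  · ring
  · rw [inside_inter, sdiff_inter_self_right, mem_sdiff] at he
    exact he.2 heA

lemma AgreesOff.charVec_eq (h : D.AgreesOff A K H) (he : e ∉ D.inside A) :
    charVec K e = charVec H e := charVec_congr (h e he)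

lemma AgreesOff.isTight_iff_of_disjoint (h : D.AgreesOff A K H) (hAB : Disjoint A B) :
    D.IsTight m (charVec K) B ↔ D.IsTight m (charVec H) B := by
  rw [IsTight, IsTight, sum_congr rfl fun e he =>
    h.charVec_eq (notMem_inside_of_disjoint hAB.symm he)]

/-- In a tight set with at least two vertices, every vertex meets an edge: otherwise deleting the
vertex would violate sparsity. -/
lemma IsTight.exists_mem_star (hm : 0 < m) (hs : D.IsSparse m (charVec H)) {T : Finset V}
    (hT : D.IsTight m (charVec H) T) (hv : v ∈ T) (hw : w ∈ T) (hvw : w ≠ v) :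
    ∃ f ∈ D.inside T, f ∈ H ∧ f ∈ D.star v := by
  by_contra! hcon
  have hsparse := hs (T.erase v) ⟨w, mem_erase.2 ⟨hvw, hw⟩⟩
  have heq : ∑ e ∈ D.inside (T.erase v), charVec H e = ∑ e ∈ D.inside T, charVec H e := by
    refine sum_subset (inside_mono (erase_subset v T)) fun e he he' => charVec_of_notMem ?_
    intro heH
    have := hcon e he heH
    simp only [mem_inside, mem_star, mem_erase] at *
    tauto
  rw [heq, hT.2, cast_card_erase_of_mem hv] at hsparse
  have : (0 : ℝ) < m := by exact_mod_cast hm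
  nlinarith

section LocalChange

variable [Fintype V]

lemma IsFracBase.of_eq_inside_of_eq_off (hx : D.IsFracBase m x) (hy : D.IsFracBase m y)
    (hxA : D.IsTight m x A) (hyA : D.IsTight m y A) (hin : ∀ e ∈ D.inside A, z e = y e)
    (hoff : ∀ e ∉ D.inside A, z e = x e) : D.IsFracBase m z := by
  classical
  have hsum (B : Finset V) : ∑ e ∈ D.inside B, z e + ∑ e ∈ D.inside (A ∩ B), x e =
      ∑ e ∈ D.inside B, x e + ∑ e ∈ D.inside (A ∩ B), y e := by
    rw [sum_inside_add_sum_inside_inter_of_eq_off hoff,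
      sum_congr rfl fun e he => hin e (inside_mono inter_subset_left he)]
  have hz (e : E) : z e = x e ∨ z e = y e := by
    by_cases he : e ∈ D.inside A
    exacts [.inr (hin e he), .inl (hoff e he)]
  refine ⟨fun e => ?_, fun e => ?_, fun B hB => ?_, hx.isTight_univ.1, ?_⟩
  · rcases hz e with h | h <;> rw [h]
    exacts [hx.nonneg e, hy.nonneg e]
  · rcases hz e with h | h <;> rw [h]
    exacts [hx.le_one e, hy.le_one e]
  · specialize hsum B
    rcases (A ∩ B).eq_empty_or_nonempty with hAB | hAB
    · simp only [hAB, inside_empty, sum_empty, add_zero] at hsum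
      exact hsum.trans_le (hx.isSparse B hB)
    · have hnonneg : 0 ≤ ∑ e ∈ D.inside (A ∪ B) \ (D.inside A ∪ D.inside B), x e :=
        sum_nonneg fun e _ => hx.nonneg e
      linarith [sum_inside_union_add_sum_inside_inter (D := D) x A B, hxA.2, hy.isSparse _ hAB,
        hx.isSparse (A ∪ B) (hxA.1.mono subset_union_left),
        mul_card_sub_one_union_add_inter (m : ℝ) A B]
  · have := hsum univ
    rw [inter_univ, hxA.2, hyA.2] at this
    linarith [hx.isTight_univ.2]

lemma AgreesOff.isTight_iff_of_subset (h : D.AgreesOff A K H) (hK : D.IsBase m K)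
    (hH : D.IsBase m H) (hAB : A ⊆ B) :
    D.IsTight m (charVec K) B ↔ D.IsTight m (charVec H) B := by
  have hoff : ∀ e ∉ D.inside B, charVec K e = charVec H e := fun e he =>
    h.charVec_eq fun heA => he (inside_mono hAB heA)
  have := sum_inside_add_sum_inside_inter_of_eq_off hoff univ
  rw [inter_univ, hK.isTight_univ.2, hH.isTight_univ.2, add_right_inj] at this
  rw [IsTight, IsTight, this]

lemma IsBase.glue {A₁ A₂ : Finset V} {K₁ K₂ : Finset E} (hA : Disjoint A₁ A₂)
    (htight : D.IsTight m (charVec H) A₂) (hH : D.IsBase m H) (hK₁ : D.IsBase m K₁)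
    (hK₂ : D.IsBase m K₂) (h₁ : D.AgreesOff A₁ K₁ H) (h₂ : D.AgreesOff A₂ K₂ H) :
    ∃ L, D.IsBase m L ∧ D.AgreesOff A₂ L K₁ ∧ D.AgreesOff A₁ L K₂ := by
  classical
  let L : Finset E := {e | if e ∈ D.inside A₂ then e ∈ K₂ else e ∈ K₁}
  have hin : ∀ e ∈ D.inside A₂, e ∈ L ↔ e ∈ K₂ := fun e he => by
    simp only [L, mem_filter, mem_univ, true_and, if_pos he]
  have hoff : D.AgreesOff A₂ L K₁ := fun e he => by
    simp only [L, mem_filter, mem_univ, true_and, if_neg he]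
  refine ⟨L, hK₁.of_eq_inside_of_eq_off hK₂ ((h₁.isTight_iff_of_disjoint hA).2 htight)
    ((h₂.isTight_iff_of_subset hK₂ hH subset_rfl).2 htight) (fun e he => charVec_congr (hin e he))
    fun e he => hoff.charVec_eq he, hoff, fun e he => ?_⟩
  by_cases he₂ : e ∈ D.inside A₂
  · exact hin e he₂
  · rw [hoff e he₂, h₁ e he, h₂ e he₂]

lemma IsBase.exists_exchange [DecidableEq E] (hm : 0 < m) (hH : D.IsBase m H) (he : e ∉ H) :
    ∃ T, D.IsTight m (charVec H) T ∧ e ∈ D.inside T ∧ ∀ v ∈ T, v ≠ D.tail e →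
      ∃ f ∈ D.inside T, f ∈ H ∧ f ∈ D.star v ∧ D.IsBase m ((insert e H).erase f) := by
  obtain ⟨T, hT, heT, hleast⟩ := hH.exists_least_isTight e
  refine ⟨T, hT, heT, fun v hv hve => ?_⟩
  obtain ⟨f, hfT, hfH, hfv⟩ :=
    hT.exists_mem_star hm hH.isSparse hv (mem_inside.1 heT).1 hve.symm
  refine ⟨f, hfT, hfH, hfv, charVec_nonneg _, charVec_le_one _, ?_, hH.isTight_univ.1, ?_⟩
  · exact hH.isSparse.exchange (erase_subset _ _) fun A hA heA =>
      ⟨f, inside_mono (hleast A hA heA) hfT, hfH, notMem_erase f _⟩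
  · rw [← hH.isTight_univ.2]
    simp only [inside_univ, sum_charVec, inter_univ]
    rw [card_erase_of_mem (mem_insert_of_mem hfH), card_insert_of_notMem he, Nat.add_sub_cancel]

/-- The base `H` can be changed inside the tight set `A`, on which it respects the degree bound `h`,
to another base that respects it there and leaves room for one more edge at `v`. -/
structure HasLocalSlack (D : OrientedMultigraph V E) (m : ℕ) (h : V → ℤ) (H : Finset E)
    (A : Finset V) (v : V) : Prop where
  mem : v ∈ A
  isTight : D.IsTight m (charVec H) A
  degree_le : ∀ w ∈ A, D.degree H w ≤ h w
  exists_base : ∃ K, D.IsBase m K ∧ D.AgreesOff A K H ∧ (∀ w ∈ A, D.degree K w ≤ h w) ∧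
    D.degree K v < h v

variable {h : V → ℤ} {A₁ A₂ : Finset V}

lemma IsBase.hasLocalSlack_singleton (hH : D.IsBase m H) (hv : D.degree H v < h v) :
    D.HasLocalSlack m h H {v} v :=
  have hle : ∀ w ∈ ({v} : Finset V), D.degree H w ≤ h w := fun w hw => by
    rw [mem_singleton.1 hw]
    exact hv.le
  ⟨mem_singleton_self v, hH.isSparse.isTight_singleton hH.nonneg v, hle, H, hH,
    fun _ _ => Iff.rfl, hle, hv⟩

lemma IsBase.exists_slack_both (hH : D.IsBase m H) (he : e ∉ H)
    (h₁ : D.HasLocalSlack m h H A₁ (D.tail e)) (h₂ : D.HasLocalSlack m h H A₂ (D.head e))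
    (hA : Disjoint A₁ A₂) :
    ∃ L, D.IsBase m L ∧ e ∉ L ∧ D.AgreesOff (A₁ ∪ A₂) L H ∧ D.IsTight m (charVec L) A₁ ∧
      D.IsTight m (charVec L) A₂ ∧ (∀ u ∈ A₁ ∪ A₂, D.degree L u ≤ h u) ∧
      D.degree L (D.tail e) < h (D.tail e) ∧ D.degree L (D.head e) < h (D.head e) := by
  obtain ⟨hv, ht₁, -, K₁, hK₁, hoff₁, hd₁, hlt₁⟩ := h₁
  obtain ⟨hw, ht₂, -, K₂, hK₂, hoff₂, hd₂, hlt₂⟩ := h₂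
  obtain ⟨L, hL, hL₁, hL₂⟩ := hH.glue hA ht₂ hK₁ hK₂ hoff₁ hoff₂
  have hdeg₁ : ∀ u ∈ A₁, D.degree L u = D.degree K₁ u := fun u hu =>
    hL₁.degree_eq (disjoint_left.1 hA hu)
  have hdeg₂ : ∀ u ∈ A₂, D.degree L u = D.degree K₂ u := fun u hu =>
    hL₂.degree_eq (disjoint_right.1 hA hu)
  have he₁ : e ∉ D.inside A₁ := fun h => disjoint_left.1 hA (mem_inside.1 h).2 hw
  have he₂ : e ∉ D.inside A₂ := fun h => disjoint_left.1 hA hv (mem_inside.1 h).1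
  refine ⟨L, hL, by rwa [hL₁ e he₂, hoff₁ e he₁], fun f hf => ?_, ?_, ?_, fun u hu => ?_,
    by rwa [hdeg₁ _ hv], by rwa [hdeg₂ _ hw]⟩
  · rw [hL₁ f fun h => hf (inside_mono subset_union_right h),
      hoff₁ f fun h => hf (inside_mono subset_union_left h)]
  · rw [hL₁.isTight_iff_of_disjoint hA.symm]
    exact (hoff₁.isTight_iff_of_subset hK₁ hH subset_rfl).2 ht₁
  · rw [hL₂.isTight_iff_of_disjoint hA]
    exact (hoff₂.isTight_iff_of_subset hK₂ hH subset_rfl).2 ht₂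
  · rcases mem_union.1 hu with hu | hu
    · rw [hdeg₁ u hu]
      exact hd₁ u hu
    · rw [hdeg₂ u hu]
      exact hd₂ u hu

lemma IsBase.exists_degree_lt (hm : 0 < m) (hH : D.IsBase m H) (he : e ∉ H)
    (h₁ : D.HasLocalSlack m h H A₁ (D.tail e)) (h₂ : D.HasLocalSlack m h H A₂ (D.head e))
    (hA : Disjoint A₁ A₂) :
    ∃ T, A₁ ∪ A₂ ⊆ T ∧ D.IsTight m (charVec H) T ∧ ∀ v ∈ T, v ∉ A₁ ∪ A₂ →
      ∃ K, D.IsBase m K ∧ D.AgreesOff T K H ∧ (∀ w ∈ A₁ ∪ A₂, D.degree K w ≤ h w) ∧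
        (∀ w ∉ A₁ ∪ A₂, D.degree K w ≤ D.degree H w) ∧ D.degree K v < D.degree H v := by
  classical
  obtain ⟨L, hL, heL, hoff, ht₁, ht₂, hle, htail, hhead⟩ := hH.exists_slack_both he h₁ h₂ hA
  obtain ⟨T, hT, heT, hexch⟩ := hL.exists_exchange hm heL
  obtain ⟨heT₁, heT₂⟩ := mem_inside.1 heT
  have hT' : D.IsTight m (charVec L) (T ∪ A₁ ∪ A₂) :=
    (hT.union hL.isSparse hL.nonneg ht₁ ⟨_, mem_inter.2 ⟨heT₁, h₁.mem⟩⟩).union hL.isSparse hL.nonneg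
      ht₂ ⟨_, mem_inter.2 ⟨mem_union_left _ heT₂, h₂.mem⟩⟩
  have hsub : A₁ ∪ A₂ ⊆ T ∪ A₁ ∪ A₂ := by grind
  refine ⟨T ∪ A₁ ∪ A₂, hsub, (hoff.isTight_iff_of_subset hL hH hsub).1 hT', fun v hv hvA => ?_⟩
  obtain ⟨f, hfT, hfL, hfv, hK⟩ := hexch v (by grind) fun h => hvA (h ▸ mem_union_left _ h₁.mem)
  have hdeg := degree_insert_erase (D := D) heL hfL
  have hstar : ∀ w ∉ A₁ ∪ A₂, e ∉ D.star w := fun w hw hew => by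
    rcases mem_star.1 hew with rfl | rfl
    exacts [hw (mem_union_left _ h₁.mem), hw (mem_union_right _ h₂.mem)]
  refine ⟨_, hK, fun g hg => ?_, fun w hw => ?_, fun w hw => ?_, ?_⟩
  · have hgT : g ∉ D.inside T := fun h => hg (inside_mono (by grind) h)
    rw [mem_erase, mem_insert, hoff g fun h => hg (inside_mono hsub h)]
    grind
  · specialize hdeg w
    by_cases hew : e ∈ D.star w
    · rw [if_pos hew] at hdeg
      rcases mem_star.1 hew with rfl | rfl <;> omega
    · have := hle w hw
      rw [if_neg hew] at hdeg
      omega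
  · have := hdeg w
    rw [if_neg (hstar w hw), hoff.degree_eq hw] at this
    omega
  · have := hdeg v
    rw [if_neg (hstar v hvA), if_pos hfv, hoff.degree_eq hvA] at this
    omega

/-- Every vertex of `U` has local slack inside `U`. -/
def IsSlackClosed (D : OrientedMultigraph V E) (m : ℕ) (h : V → ℤ) (H : Finset E) (U : Finset V) :
    Prop := ∀ v ∈ U, ∃ A ⊆ U, D.HasLocalSlack m h H A v

/-- The total amount by which the base `H` exceeds the degree bound `h`. -/
def excess (D : OrientedMultigraph V E) (h : V → ℤ) (H : Finset E) : ℕ :=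
  ∑ v, (D.degree H v - h v).toNat

lemma exists_maximal_isSlackClosed (D : OrientedMultigraph V E) (m : ℕ) (h : V → ℤ)
    (H : Finset E) : ∃ U, D.IsSlackClosed m h H U ∧
      ∀ W, U ⊆ W → (∀ v ∈ W, v ∉ U → ∃ A ⊆ W, D.HasLocalSlack m h H A v) → W ⊆ U := by
  classical
  obtain ⟨U, -, hU⟩ := ({U | D.IsSlackClosed m h H U} : Finset (Finset V)).exists_le_maximal
    (a := ∅) (mem_filter.2 ⟨mem_univ ∅, fun v hv => absurd hv (notMem_empty v)⟩)
  have hclosed : D.IsSlackClosed m h H U := (mem_filter.1 hU.1).2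
  refine ⟨U, hclosed, fun W hUW hW => (hU.eq_of_le ?_ hUW).ge⟩
  refine mem_filter.2 ⟨mem_univ W, fun v hv => ?_⟩
  by_cases hvU : v ∈ U
  · obtain ⟨A, hA, hslack⟩ := hclosed v hvU
    exact ⟨A, hA.trans hUW, hslack⟩
  · exact hW v hv hvU

lemma IsBase.exists_isTight_of_mem_inside (hm : 0 < m) (hH : D.IsBase m H)
    (hmin : ∀ K, D.IsBase m K → D.excess h H ≤ D.excess h K) (hU : D.IsSlackClosed m h H U)
    (hmax : ∀ W, U ⊆ W → (∀ v ∈ W, v ∉ U → ∃ A ⊆ W, D.HasLocalSlack m h H A v) → W ⊆ U)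
    (heU : e ∈ D.inside U) (heH : e ∉ H) :
    ∃ A ⊆ U, D.IsTight m (charVec H) A ∧ e ∈ D.inside A := by
  obtain ⟨A₁, hA₁U, h₁⟩ := hU _ (mem_inside.1 heU).1
  obtain ⟨A₂, hA₂U, h₂⟩ := hU _ (mem_inside.1 heU).2
  by_cases hdis : Disjoint A₁ A₂
  swap
  · exact ⟨A₁ ∪ A₂, union_subset hA₁U hA₂U, h₁.isTight.union hH.isSparse hH.nonneg h₂.isTight
      (not_disjoint_iff_nonempty_inter.1 hdis),
      mem_inside.2 ⟨mem_union_left _ h₁.mem, mem_union_right _ h₂.mem⟩⟩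
  obtain ⟨T, hAT, hT, hexch⟩ := hH.exists_degree_lt hm heH h₁ h₂ hdis
  have hAU := union_subset hA₁U hA₂U
  suffices hTU : T ⊆ U from ⟨T, hTU, hT,
    mem_inside.2 ⟨hAT (mem_union_left _ h₁.mem), hAT (mem_union_right _ h₂.mem)⟩⟩
  have hle : ∀ v ∈ T, D.degree H v ≤ h v := by
    by_contra! ⟨v, hvT, hv⟩
    have hvA : v ∉ A₁ ∪ A₂ := fun hvA => by
      obtain ⟨A, -, hA⟩ := hU v (hAU hvA)
      exact (hA.degree_le v hA.mem).not_gt hv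
    obtain ⟨K, hK, -, hd, hd', hlt⟩ := hexch v hvT hvA
    refine (hmin K hK).not_gt (sum_lt_sum (fun w _ => ?_) ⟨v, mem_univ v, by omega⟩)
    by_cases hw : w ∈ A₁ ∪ A₂
    · have := hd w hw
      omega
    · have := hd' w hw
      omega
  refine subset_union_right.trans (hmax (U ∪ T) subset_union_left fun v hv hvU => ?_)
  have hvT := (mem_union.1 hv).resolve_left hvU
  obtain ⟨K, hK, hoff, hd, hd', hlt⟩ := hexch v hvT fun h => hvU (hAU h)
  refine ⟨T, subset_union_right, hvT, hT, hle, K, hK, hoff, fun w hw => ?_, by grind⟩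
  by_cases hwA : w ∈ A₁ ∪ A₂
  · exact hd w hwA
  · exact (Int.ofNat_le.2 (hd' w hwA)).trans (hle w hw)

/-- Take a base of least excess and let `S` be the complement of a maximal set all of whose vertices
have local slack in it: every missing edge outside `S` lies in a tight set outside `S`. -/
theorem IsFracBase.exists_degree_le_or_saturated (hm : 0 < m) (hz : D.IsFracBase m z) (h : V → ℤ) :
    (∃ H, D.IsBase m H ∧ ∀ v, D.degree H v ≤ h v) ∨
    ∃ (H : Finset E) (S : Finset V), D.IsBase m H ∧ (∀ v ∈ S, h v ≤ D.degree H v) ∧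
      (∃ v ∈ S, h v < D.degree H v) ∧
      ∑ e ∈ D.inside Sᶜ, z e ≤ ∑ e ∈ D.inside Sᶜ, charVec H e := by
  classical
  obtain ⟨H, hH, hmin⟩ := exists_min_image ({H | D.IsBase m H}) (D.excess h) (by
    simpa [Finset.Nonempty] using hz.exists_isBase)
  simp only [mem_filter, mem_univ, true_and] at hH hmin
  by_cases hgood : ∀ v, D.degree H v ≤ h v
  · exact .inl ⟨H, hH, hgood⟩
  push Not at hgood
  obtain ⟨v₀, hv₀⟩ := hgood
  obtain ⟨U, hU, hmax⟩ := D.exists_maximal_isSlackClosed m h H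
  refine .inr ⟨H, Uᶜ, hH, fun v hv => ?_, ⟨v₀, mem_compl.2 fun hv => ?_, hv₀⟩, ?_⟩
  · by_contra! hlt
    refine mem_compl.1 hv (hmax (insert v U) (subset_insert v U) (fun w hw hwU => ?_)
      (mem_insert_self v U))
    obtain rfl : w = v := (mem_insert.1 hw).resolve_right hwU
    exact ⟨{w}, by simp, hH.hasLocalSlack_singleton hlt⟩
  · obtain ⟨A, -, hA⟩ := hU v₀ hv
    exact (hA.degree_le v₀ hA.mem).not_gt hv₀
  · rw [compl_compl]
    exact sum_inside_le_sum_charVec hz.isSparse hz.le_one hH.isSparse U fun e heU heH =>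
      hH.exists_isTight_of_mem_inside hm hmin hU hmax heU heH

end LocalChange

/-! ### Integrality -/

/-- The coordinates at which `x` is not an integer. -/
noncomputable def fractional {E : Type*} [Fintype E] (x : E → ℝ) : Finset E := by
  classical exact {e | x e ∉ (Int.castAddHom ℝ).range}

section Fractional

variable {E : Type*} [Fintype E] {x : E → ℝ} {e : E}

lemma mem_fractional : e ∈ fractional x ↔ x e ∉ (Int.castAddHom ℝ).range := by simp [fractional]

lemma card_filter_fractional_ne_one {S : Finset E} [DecidablePred (· ∈ fractional x)]
    (h : ∑ e ∈ S, x e ∈ (Int.castAddHom ℝ).range) : #{e ∈ S | e ∈ fractional x} ≠ 1 := by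
  intro hcard
  obtain ⟨e, he⟩ := card_eq_one.1 hcard
  have hmem : e ∈ S ∧ e ∈ fractional x := mem_filter.1 (he ▸ mem_singleton_self e)
  refine mem_fractional.1 hmem.2 ?_
  rw [← sum_filter_add_sum_filter_not S (· ∈ fractional x), he, sum_singleton] at h
  refine (add_mem_cancel_right (sum_mem fun f hf => ?_)).1 h
  by_contra hf'
  exact (mem_filter.1 hf).2 (mem_fractional.2 hf')

lemma charVec_mem_range {E : Type*} (H : Finset E) (e : E) :
    charVec H e ∈ (Int.castAddHom ℝ).range := by
  by_cases he : e ∈ H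
  · exact ⟨1, by simp [charVec_of_mem he]⟩
  · exact ⟨0, by simp [charVec_of_notMem he]⟩

lemma exists_eq_charVec (h₀ : ∀ e, 0 ≤ x e) (h₁ : ∀ e, x e ≤ 1) (hx : fractional x = ∅) :
    ∃ H : Finset E, x = charVec H := by
  classical
  refine ⟨({e | x e = 1} : Finset E), funext fun e => ?_⟩
  obtain ⟨n, hn⟩ : x e ∈ (Int.castAddHom ℝ).range := by
    by_contra he
    exact notMem_empty e (hx ▸ mem_fractional.2 he)
  change (n : ℝ) = x e at hn
  have hn₀ : 0 ≤ n := by exact_mod_cast hn ▸ h₀ e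
  have hn₁ : n ≤ 1 := by exact_mod_cast hn ▸ h₁ e
  by_cases he : x e = 1
  · rw [charVec_of_mem (by simpa using he), he]
  · obtain rfl : n = 0 := hn₁.lt_or_eq.elim (by omega) fun h => absurd hn.symm (by simpa [h])
    rw [charVec_of_notMem (by simpa using he), ← hn, Int.cast_zero]

end Fractional

lemma IsTight.sum_mem_range (h : D.IsTight m x A) :
    ∑ e ∈ D.inside A, x e ∈ (Int.castAddHom ℝ).range :=
  ⟨m * (#A - 1), by rw [h.2]; simp⟩

lemma eventually_add_mul_mem_Icc (hx₀ : 0 ≤ x e) (hx₁ : x e ≤ 1)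
    (hy : e ∉ fractional x → y e = 0) :
    ∀ᶠ r in 𝓝 (0 : ℝ), 0 ≤ x e + r * y e ∧ x e + r * y e ≤ 1 := by
  have hint : x e ∈ (Int.castAddHom ℝ).range → y e = 0 := fun h =>
    hy fun he => mem_fractional.1 he h
  have hlow := eventually_add_mul_le (neg_nonpos.2 hx₀) (c := -y e) fun h => by
    rw [hint ⟨0, by simpa using neg_eq_zero.1 h |>.symm⟩, neg_zero]
  have hup := eventually_add_mul_le hx₁ (c := y e) fun h => hint ⟨1, by simp [h]⟩
  filter_upwards [hlow, hup] with r hr₀ hr₁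
  exact ⟨by linarith, hr₁⟩

/-- Call two fractional edges equivalent if they lie in the same tight sets. A class is cut out of
the least tight set around it by the smaller tight sets, all of which carry integral weight. -/
lemma IsFracBase.exists_classes [Fintype V] (hx : D.IsFracBase m x) :
    ∃ p : E → Finset V, (∀ A, D.IsTight m x A → ∀ e, e ∈ D.inside A ↔ p e ⊆ A) ∧
      ∀ k, #{e ∈ fractional x | p e = k} ≠ 1 := by
  classical
  choose p hp hmem hmin using hx.exists_least_isTight
  have hiff : ∀ A, D.IsTight m x A → ∀ e, e ∈ D.inside A ↔ p e ⊆ A := fun A hA e =>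
    ⟨hmin e A hA, fun h => inside_mono h (hmem e)⟩
  refine ⟨p, hiff, fun k hk => ?_⟩
  obtain ⟨e, he⟩ := card_eq_one.1 hk
  obtain ⟨hefrac, rfl⟩ : e ∈ fractional x ∧ p e = k := mem_filter.1 (he ▸ mem_singleton_self e)
  let P : Finset V → Prop := fun A => D.IsTight m x A ∧ A ⊆ p e ∧ e ∉ D.inside A
  have hpos : 0 < x e := (hx.nonneg e).lt_of_ne' fun h =>
    mem_fractional.1 hefrac ⟨0, by simp [h]⟩
  obtain ⟨𝓜, hM, hsum⟩ := D.exists_sum_covered_eq_sum P fun A B hA hB hAB =>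
    ⟨hA.1.union hx.isSparse hx.nonneg hB.1 hAB, union_subset hA.2.1 hB.2.1, fun heAB =>
      (hA.1.mem_inside_of_mem_inside_union hx.isSparse hx.nonneg hB.1 hAB heAB hpos).elim
        hA.2.2 hB.2.2⟩
  have hsub : D.covered P ⊆ D.inside (p e) := fun f hf => by
    obtain ⟨A, hA, hfA⟩ := mem_covered.1 hf
    exact inside_mono hA.2.1 hfA
  refine card_filter_fractional_ne_one (x := x) (S := D.inside (p e) \ D.covered P) ?_ ?_
  · rw [sum_sdiff_eq_sub hsub, hsum]
    exact sub_mem (hp e).sum_mem_range (sum_mem fun A hA => (hM A hA).1.sum_mem_range)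
  · rw [← hk]
    refine congrArg card (ext fun f => ?_)
    simp only [mem_filter, mem_sdiff, mem_covered, not_exists, not_and]
    constructor
    · rintro ⟨⟨hf, hfP⟩, hffrac⟩
      have hfe : p f ⊆ p e := hmin f _ (hp e) hf
      refine ⟨hffrac, hfe.antisymm (hmin e _ (hp f) ?_)⟩
      by_contra h
      exact hfP _ ⟨hp f, hfe, h⟩ (hmem f)
    · rintro ⟨hffrac, hfe⟩
      refine ⟨⟨hfe ▸ hmem f, fun A hA hfA => hA.2.2 ((hiff A hA.1 e).2 ?_)⟩, hffrac⟩
      exact hfe ▸ (hiff A hA.1 f).1 hfA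

lemma sum_inside_eq_zero_of_sum_class_eq_zero (p : E → Finset V)
    (hp : ∀ e, e ∈ D.inside A ↔ p e ⊆ A) (hy : ∀ e ∉ fractional x, y e = 0)
    (hsum : ∀ k, ∑ e ∈ fractional x with p e = k, y e = 0) : ∑ e ∈ D.inside A, y e = 0 := by
  classical
  rw [← sum_filter_of_ne (p := (· ∈ fractional x)) fun e _ he => by_contra fun h => he (hy e h)]
  rw [← sum_fiberwise_of_maps_to (t := A.powerset) (g := p) fun e he =>
    mem_powerset.2 ((hp e).1 (mem_filter.1 he).1)]
  refine sum_eq_zero fun k hk => (sum_congr (ext fun e => ?_) fun _ _ => rfl).trans (hsum k)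
  have : p e = k → e ∈ D.inside A := fun h => (hp e).2 (h ▸ mem_powerset.1 hk)
  simp only [mem_filter]
  tauto

lemma IsFracBase.eventually_add_smul [Fintype V] (hx : D.IsFracBase m x)
    (hy : ∀ e ∉ fractional x, y e = 0)
    (hsum : ∀ A, D.IsTight m x A → ∑ e ∈ D.inside A, y e = 0) :
    ∀ᶠ r : ℝ in 𝓝 0, D.IsFracBase m (x + r • y) := by
  have hbox : ∀ᶠ r : ℝ in 𝓝 0, ∀ e, 0 ≤ x e + r * y e ∧ x e + r * y e ≤ 1 :=
    Filter.eventually_all.2 fun e => eventually_add_mul_mem_Icc (hx.nonneg e) (hx.le_one e) (hy e)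
  have hsparse : ∀ᶠ r : ℝ in 𝓝 0, ∀ A : Finset V, A.Nonempty →
      ∑ e ∈ D.inside A, x e + r * ∑ e ∈ D.inside A, y e ≤ m * ((#A : ℝ) - 1) :=
    Filter.eventually_all.2 fun A => Filter.eventually_imp_distrib_left.2 fun hA =>
      eventually_add_mul_le (hx.isSparse A hA) fun h => hsum A ⟨hA, h⟩
  filter_upwards [hbox, hsparse] with r hr hrs
  have hadd (A : Finset V) : ∑ e ∈ D.inside A, (x + r • y) e =
      ∑ e ∈ D.inside A, x e + r * ∑ e ∈ D.inside A, y e := by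
    simp [sum_add_distrib, mul_sum]
  refine ⟨fun e => (hr e).1, fun e => (hr e).2, fun A hA => (hadd A).trans_le (hrs A hA),
    hx.isTight_univ.1, ?_⟩
  rw [hadd, hsum _ hx.isTight_univ, hx.isTight_univ.2, mul_zero, add_zero]

lemma IsFracBase.exists_partition [Fintype V] (hx : D.IsFracBase m x) :
    ∃ p : E → Finset V, (∀ k, #{e ∈ fractional x | p e = k} ≠ 1) ∧
      ∀ y : E → ℝ, (∀ e ∉ fractional x, y e = 0) →
        (∀ k, ∑ e ∈ fractional x with p e = k, y e = 0) →
        ∀ᶠ r : ℝ in 𝓝 0, D.IsFracBase m (x + r • y) := by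
  obtain ⟨p, hp, hcard⟩ := hx.exists_classes
  exact ⟨p, hcard, fun y hy hsum => hx.eventually_add_smul hy fun A hA =>
    sum_inside_eq_zero_of_sum_class_eq_zero p (hp A hA) hy hsum⟩

lemma isCompact_setOf_isFracBase [Fintype V] (D : OrientedMultigraph V E) (m : ℕ) :
    IsCompact {x | D.IsFracBase m x} := by
  refine isCompact_Icc.of_isClosed_subset (s := Set.Icc (0 : E → ℝ) 1) ?_ fun x hx =>
    ⟨hx.nonneg, hx.le_one⟩
  have hsparse : IsClosed {x | D.IsSparse m x} := by
    simp only [IsSparse, Set.ofPred_forall]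
    exact isClosed_iInter fun A => isClosed_iInter fun _ => isClosed_le (by fun_prop) (by fun_prop)
  have htight : IsClosed {x | D.IsTight m x univ} :=
    isClosed_const.and (isClosed_eq (by fun_prop) (by fun_prop))
  have heq : {x | D.IsFracBase m x} =
      Set.Icc 0 1 ∩ ({x | D.IsSparse m x} ∩ {x | D.IsTight m x univ}) :=
    Set.ext fun x => ⟨fun h => ⟨⟨h.1, h.2⟩, h.3, h.4⟩, fun h => ⟨h.1.1, h.1.2, h.2.1, h.2.2⟩⟩
  rw [heq]
  exact isClosed_Icc.inter (hsparse.inter htight)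

lemma fractional_eq_empty_of_mem_extremePoints_degree_le [Fintype V] {X : Set V} {h : V → ℤ}
    (hX : ∀ e, D.tail e ∈ X → D.head e ∉ X)
    (hx : x ∈ {x | D.IsFracBase m x ∧ ∀ v ∈ X, ∑ e ∈ D.star v, x e ≤ h v}.extremePoints ℝ) :
    fractional x = ∅ := by
  classical
  obtain ⟨hxm, hxh⟩ := hx.1
  obtain ⟨p, hp, hxy⟩ := hxm.exists_partition
  refine eq_empty_of_mem_extremePoints hx (A := fun k => {e ∈ fractional x | p e = k})
    (B := fun v : {v // v ∈ X ∧ ∑ e ∈ D.star v, x e = h v} => {e ∈ D.star v | e ∈ fractional x})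
    (fun k l hkl => disjoint_left.2 fun e hk hl =>
      hkl ((mem_filter.1 hk).2.symm.trans (mem_filter.1 hl).2))
    (fun v w hvw => disjoint_left.2 fun e hv hw => ?_)
    (fun k => filter_subset _ _) (fun v e he => (mem_filter.1 he).2) hp
    (fun v => card_filter_fractional_ne_one ⟨h v, v.2.2.symm⟩) fun y hy hyp hyv => ?_
  · have hne : v.1 ≠ w := Subtype.coe_ne_coe.2 hvw
    rcases mem_star.1 (mem_filter.1 hv).1 with hev | hev <;>
      rcases mem_star.1 (mem_filter.1 hw).1 with hew | hew
    · exact hne (hev.symm.trans hew)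
    · exact hX e (hev ▸ v.2.1) (hew ▸ w.2.1)
    · exact hX e (hew ▸ w.2.1) (hev ▸ v.2.1)
    · exact hne (hev.symm.trans hew)
  · have hdeg : ∀ᶠ r : ℝ in 𝓝 0, ∀ v, v ∈ X →
        ∑ e ∈ D.star v, x e + r * ∑ e ∈ D.star v, y e ≤ h v :=
      Filter.eventually_all.2 fun v => Filter.eventually_imp_distrib_left.2 fun hv =>
        eventually_add_mul_le (hxh v hv) fun heq => by
          rw [← sum_filter_of_ne fun e _ he => by_contra fun hf => he (hy e hf)]
          exact hyv ⟨v, hv, heq⟩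
    filter_upwards [hxy y hy hyp, hdeg] with r hr hrh
    refine ⟨hr, fun v hv => ?_⟩
    simpa [sum_add_distrib, mul_sum] using hrh v hv

theorem IsFracBase.exists_isBase_degree_le [Fintype V] {X : Set V} (hz : D.IsFracBase m z)
    (hX : ∀ e, D.tail e ∈ X → D.head e ∉ X) (h : V → ℤ)
    (hzh : ∀ v ∈ X, ∑ e ∈ D.star v, z e ≤ h v) (u : V) :
    ∃ H, D.IsBase m H ∧ (∀ v ∈ X, D.degree H v ≤ h v) ∧
      (D.degree H u : ℝ) ≤ ∑ e ∈ D.star u, z e := by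
  have hclosed : IsClosed {x : E → ℝ | ∀ v ∈ X, ∑ e ∈ D.star v, x e ≤ h v} := by
    simp only [Set.ofPred_forall]
    exact isClosed_iInter fun v => isClosed_iInter fun _ =>
      isClosed_le (by fun_prop) continuous_const
  obtain ⟨x, hx, hxu⟩ := exists_mem_extremePoints_le
    ((D.isCompact_setOf_isFracBase m).inter_right hclosed) ⟨hz, hzh⟩
    (∑ e ∈ D.star u, ContinuousLinearMap.proj e)
  obtain ⟨hxm, hxh⟩ := hx.1
  obtain ⟨H, rfl⟩ := exists_eq_charVec hxm.nonneg hxm.le_one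
    (fractional_eq_empty_of_mem_extremePoints_degree_le hX hx)
  refine ⟨H, hxm, fun v hv => ?_, ?_⟩
  · have := hxh v hv
    rw [← cast_degree] at this
    exact_mod_cast this
  · rw [cast_degree]
    simpa using hxu

/-! ### Decomposing a base into trees -/

lemma IsFracBase.smul_div [Fintype V] {k l : ℕ} (hx : D.IsFracBase k x) (hl : l ≤ k) :
    D.IsFracBase l ((l / k : ℝ) • x) := by
  have hlk : (l / k : ℝ) ≤ 1 := div_le_one_of_le₀ (by exact_mod_cast hl) k.cast_nonneg
  have hlk₀ : (0 : ℝ) ≤ l / k := by positivity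
  have hsum (A : Finset V) : ∑ e ∈ D.inside A, ((l / k : ℝ) • x) e =
      l / k * ∑ e ∈ D.inside A, x e := by simp [mul_sum]
  have hcancel (a : ℝ) : l / k * (k * a) = l * a := by
    rw [← mul_assoc, div_mul_cancel_of_imp fun hk => ?_]
    rw [Nat.cast_eq_zero] at hk ⊢
    omega
  refine ⟨fun e => mul_nonneg hlk₀ (hx.nonneg e), fun e => mul_le_one₀ hlk (hx.nonneg e)
    (hx.le_one e), fun A hA => ?_, hx.isTight_univ.1, ?_⟩
  · rw [hsum, ← hcancel]
    exact mul_le_mul_of_nonneg_left (hx.isSparse A hA) hlk₀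
  · rw [hsum, hx.isTight_univ.2, hcancel]

lemma fractional_sub_of_mem_range {E : Type*} [Fintype E] {x y : E → ℝ}
    (h : ∀ e, x e ∈ (Int.castAddHom ℝ).range) : fractional (x - y) = fractional y := by
  ext e
  rw [mem_fractional, mem_fractional, Pi.sub_apply, sub_eq_add_neg, add_mem_cancel_left (h e),
    neg_mem_iff]

lemma fractional_eq_empty_of_mem_extremePoints_sub [Fintype V] {k l : ℕ} {B : Finset E}
    (hx : x ∈ {x | D.IsFracBase k x ∧ D.IsFracBase l (charVec B - x)}.extremePoints ℝ) :
    fractional x = ∅ := by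
  classical
  obtain ⟨hxk, hxl⟩ := hx.1
  obtain ⟨p, hp, hxp⟩ := hxk.exists_partition
  obtain ⟨q, hq, hxq⟩ := hxl.exists_partition
  rw [fractional_sub_of_mem_range (charVec_mem_range B)] at hq hxq
  refine eq_empty_of_mem_extremePoints hx (A := fun k => {e ∈ fractional x | p e = k})
    (B := fun k => {e ∈ fractional x | q e = k})
    (fun k l hkl => disjoint_left.2 fun e hk hl =>
      hkl ((mem_filter.1 hk).2.symm.trans (mem_filter.1 hl).2))
    (fun k l hkl => disjoint_left.2 fun e hk hl =>
      hkl ((mem_filter.1 hk).2.symm.trans (mem_filter.1 hl).2))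
    (fun k => filter_subset _ _) (fun k => filter_subset _ _) hp hq fun y hy hyp hyq => ?_
  filter_upwards [hxp y hy hyp, hxq (-y) (by simpa using hy) (by simpa using hyq)] with r hr hr'
  refine ⟨hr, ?_⟩
  rwa [smul_neg, ← sub_eq_add_neg, sub_sub] at hr'

lemma charVec_sdiff {E : Type*} [DecidableEq E] {H B : Finset E} (h : H ⊆ B) :
    charVec (B \ H) = charVec B - charVec H := by
  rw [charVec, coe_sdiff, Set.indicator_sdiff (coe_subset.2 h)]
  rfl

lemma IsBase.exists_isBase_isBase_sdiff [Fintype V] [DecidableEq E] {k l : ℕ} {B : Finset E}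
    (hB : D.IsBase (k + l) B) : ∃ H ⊆ B, D.IsBase k H ∧ D.IsBase l (B \ H) := by
  obtain hkl | hkl := Nat.eq_zero_or_pos (k + l)
  · obtain ⟨rfl, rfl⟩ := Nat.add_eq_zero_iff.1 hkl
    exact ⟨∅, empty_subset B, by simpa [IsBase, charVec, Pi.zero_def] using hB.smul_div le_rfl,
      by simpa using hB⟩
  have hz : D.IsFracBase k ((k / (k + l : ℕ) : ℝ) • charVec B) := hB.smul_div (by omega)
  have hz' : D.IsFracBase l (charVec B - (k / (k + l : ℕ) : ℝ) • charVec B) := by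
    have hcoef : (1 - k / (k + l : ℕ) : ℝ) = l / (k + l : ℕ) := by
      have : ((k + l : ℕ) : ℝ) ≠ 0 := by exact_mod_cast hkl.ne'
      field_simp
      push_cast
      ring
    have := hB.smul_div (Nat.le_add_left l k)
    rwa [← hcoef, sub_smul, one_smul] at this
  have hclosed : IsClosed {x | D.IsFracBase l (charVec B - x)} :=
    (D.isCompact_setOf_isFracBase l).isClosed.preimage (by fun_prop)
  obtain ⟨x, hx⟩ := ((D.isCompact_setOf_isFracBase k).inter_right hclosed).extremePoints_nonempty
    ⟨_, hz, hz'⟩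
  obtain ⟨hxk, hxl⟩ := hx.1
  obtain ⟨H, rfl⟩ := exists_eq_charVec hxk.nonneg hxk.le_one
    (fractional_eq_empty_of_mem_extremePoints_sub hx)
  have hHB : H ⊆ B := fun e heH => by
    by_contra heB
    have := hxl.nonneg e
    rw [Pi.sub_apply, charVec_of_mem heH, charVec_of_notMem heB] at this
    linarith
  exact ⟨H, hHB, hxk, by rwa [IsBase, charVec_sdiff hHB]⟩

lemma IsBase.exists_disjoint_trees [Fintype V] {B : Finset E} (hB : D.IsBase m B) :
    ∃ T : Fin m → Finset E, (∀ i, T i ⊆ B ∧ D.IsBase 1 (T i)) ∧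
      Pairwise fun i j => Disjoint (T i) (T j) := by
  classical
  induction m generalizing B with
  | zero => exact ⟨Fin.elim0, fun i => i.elim0, fun i => i.elim0⟩
  | succ m ih =>
    obtain ⟨H, hHB, hB', hH⟩ := hB.exists_isBase_isBase_sdiff
    obtain ⟨T, hT, hdisj⟩ := ih hB'
    have hdisj' (i) : Disjoint (B \ H) (T i) := disjoint_sdiff_self_left.mono_right (hT i).1
    refine ⟨Fin.cons (B \ H) T, fun i => ?_, fun i j hij => ?_⟩
    · cases i using Fin.cases with
      | zero => exact ⟨sdiff_subset, hH⟩
      | succ i => exact ⟨(hT i).1.trans hHB, (hT i).2⟩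
    · cases i using Fin.cases <;> cases j using Fin.cases
      · exact absurd rfl hij
      · exact hdisj' _
      · exact (hdisj' _).symm
      · exact hdisj (ne_of_apply_ne Fin.succ hij)

/-! ### Degree bounds from a dominated fractional base -/

/-- The edges with at least one end in `S`. -/
def touching (D : OrientedMultigraph V E) (S : Finset V) : Finset E :=
  {e | D.tail e ∈ S ∨ D.head e ∈ S}

/-- The weight that `z` puts on the edges touching a vertex set `S` is bounded in terms of the
degrees in `S` and of the number of edges inside `S`; every vertex other than the root `u`
contributes an allowance `a`. -/
def IsDominated (D : OrientedMultigraph V E) (z : E → ℝ) (u : V) (a q l : ℝ) : Prop :=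
  ∀ S : Finset V, ∑ e ∈ D.touching S, z e ≤
    a * #(S.erase u) + q * ∑ v ∈ S, (#(D.star v) : ℝ) - l * #(D.inside S)

@[simp] lemma mem_touching {S : Finset V} : e ∈ D.touching S ↔ D.tail e ∈ S ∨ D.head e ∈ S := by
  simp [touching]

lemma touching_singleton (D : OrientedMultigraph V E) (v : V) : D.touching {v} = D.star v := by
  ext
  simp

lemma sum_touching_add_sum_inside_compl [Fintype V] (g : E → ℝ) (S : Finset V) :
    ∑ e ∈ D.touching S, g e + ∑ e ∈ D.inside Sᶜ, g e = ∑ e, g e := by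
  classical
  rw [← sum_compl_add_sum (D.inside Sᶜ)]
  congr 2
  ext
  simp only [mem_touching, mem_inside, mem_compl]
  tauto

lemma sum_sum_star (hD : ∀ e, D.tail e ≠ D.head e) (g : E → ℝ) (S : Finset V) :
    ∑ v ∈ S, ∑ e ∈ D.star v, g e = ∑ e ∈ D.touching S, g e + ∑ e ∈ D.inside S, g e := by
  simp only [star, touching, inside, sum_filter]
  rw [sum_comm, ← sum_add_distrib]
  refine sum_congr rfl fun e _ => ?_
  have hsplit (v : V) : (if D.tail e = v ∨ D.head e = v then g e else 0) =
      (if D.tail e = v then g e else 0) + if D.head e = v then g e else 0 := by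
    have := hD e
    grind
  simp only [hsplit, sum_add_distrib, sum_ite_eq]
  by_cases ht : D.tail e ∈ S <;> by_cases hh : D.head e ∈ S <;> simp [ht, hh]

lemma sum_card_star (hD : ∀ e, D.tail e ≠ D.head e) (S : Finset V) :
    ∑ v ∈ S, (#(D.star v) : ℝ) = #(D.touching S) + #(D.inside S) := by
  simpa using sum_sum_star hD (fun _ => 1) S

lemma IsFracBase.sum_eq [Fintype V] (hz : D.IsFracBase m z) :
    ∑ e, z e = m * ((Fintype.card V : ℝ) - 1) := by
  simpa using hz.isTight_univ.2

lemma IsSparse.sum_inside_charVec_le (hH : D.IsSparse m (charVec H)) {S : Finset V}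
    (hS : S.Nonempty) (u : V) {l : ℝ} (hl₀ : 0 ≤ l) (hl₁ : l ≤ 1) :
    ∑ e ∈ D.inside S, charVec H e ≤ l * #(D.inside S) + (1 - l) * (m * #(S.erase u)) := by
  have hinside : ∑ e ∈ D.inside S, charVec H e ≤ #(D.inside S) := by
    simpa using sum_le_sum fun e (_ : e ∈ D.inside S) => charVec_le_one H e
  have hcard : (#S : ℝ) - 1 ≤ #(S.erase u) := by
    have : #S ≤ #(S.erase u) + 1 := tsub_le_iff_right.1 (pred_card_le_card_erase (a := u))
    exact sub_le_iff_le_add.2 (by exact_mod_cast this)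
  have hsparse := (hH S hS).trans (mul_le_mul_of_nonneg_left hcard m.cast_nonneg)
  linarith [mul_le_mul_of_nonneg_left hinside hl₀,
    mul_le_mul_of_nonneg_left hsparse (sub_nonneg.2 hl₁)]

lemma IsDominated.sum_degree_le [Fintype V] (hD : ∀ e, D.tail e ≠ D.head e) {u : V} {a q l : ℝ}
    (hdom : D.IsDominated z u a q l) (hz : D.IsFracBase m z) (hH : D.IsBase m H) (hl₀ : 0 ≤ l)
    (hl₁ : l ≤ 1) {S : Finset V} (hS : S.Nonempty)
    (hle : ∑ e ∈ D.inside Sᶜ, z e ≤ ∑ e ∈ D.inside Sᶜ, charVec H e) :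
    ∑ v ∈ S, (D.degree H v : ℝ) ≤
      q * ∑ v ∈ S, (#(D.star v) : ℝ) + (a + m * (1 - l)) * #(S.erase u) := by
  have hz_compl := sum_touching_add_sum_inside_compl (D := D) z S
  have hH_compl := sum_touching_add_sum_inside_compl (D := D) (charVec H) S
  rw [hz.sum_eq] at hz_compl
  rw [hH.sum_eq] at hH_compl
  simp only [cast_degree, sum_sum_star hD]
  linarith [hdom S, hH.isSparse.sum_inside_charVec_le hS u hl₀ hl₁]

/-- One unit gained by integrality at `j` outweighs the rounding down at `i`. -/
lemma sum_lt_sum_of_lt_add_one {ι : Type*} {S : Finset ι} {i j : ι} {c : ι → ℝ} {d : ι → ℕ}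
    {h : ι → ℤ} (hc : ∀ v, v ≠ i → c v ≤ h v) (hi : c i < h i + 1) (hd : ∀ v ∈ S, h v ≤ d v)
    (hj : j ∈ S) (hlt : h j < d j) : ∑ v ∈ S, c v < ∑ v ∈ S, (d v : ℝ) := by
  classical
  have hint : ∑ v ∈ S, (h v : ℝ) + 1 ≤ ∑ v ∈ S, (d v : ℝ) := by
    exact_mod_cast Int.add_one_le_iff.2 (sum_lt_sum hd ⟨j, hj, hlt⟩)
  have hle : ∑ v ∈ S.erase i, c v ≤ ∑ v ∈ S.erase i, (h v : ℝ) :=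
    sum_le_sum fun v hv => hc v (ne_of_mem_erase hv)
  by_cases hiS : i ∈ S
  · rw [← add_sum_erase S _ hiS] at hint ⊢
    linarith
  · rw [erase_eq_of_notMem hiS] at hle
    linarith

theorem IsDominated.exists_isBase_degree_le [Fintype V] (hD : ∀ e, D.tail e ≠ D.head e)
    (hm : 0 < m) {u : V} {a q l : ℝ} (hdom : D.IsDominated z u a q l) (hz : D.IsFracBase m z)
    (ha : 0 ≤ a) (hl₀ : 0 ≤ l) (hl₁ : l ≤ 1) :
    ∃ H, D.IsBase m H ∧
      (∀ v, (D.degree H v : ℤ) ≤ ⌈q * #(D.star v) + (a + m * (1 - l))⌉) ∧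
      (D.degree H u : ℤ) ≤ ⌊q * #(D.star u)⌋ := by
  set b : ℝ := a + m * (1 - l)
  have hb₀ : 0 ≤ b := add_nonneg ha (mul_nonneg m.cast_nonneg (sub_nonneg.2 hl₁))
  rcases hz.exists_degree_le_or_saturated hm
    fun v => if v = u then ⌊q * #(D.star v)⌋ else ⌈q * #(D.star v) + b⌉ with
    ⟨H, hH, hdeg⟩ | ⟨H, S, hH, hsat, ⟨w, hwS, hw⟩, hle⟩
  · have hu : (D.degree H u : ℤ) ≤ ⌊q * #(D.star u)⌋ := by simpa using hdeg u
    refine ⟨H, hH, fun v => ?_, hu⟩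
    rcases eq_or_ne v u with rfl | hv
    · exact hu.trans ((Int.floor_le_ceil _).trans (Int.ceil_mono (le_add_of_nonneg_right hb₀)))
    · simpa [hv] using hdeg v
  · have hlower := sum_lt_sum_of_lt_add_one
      (c := fun v => q * #(D.star v) + if v = u then 0 else b) (i := u)
      (fun v hv => by simpa [hv] using Int.le_ceil _) (by simp) hsat hwS hw
    have hsum : ∑ v ∈ S, (q * #(D.star v) + if v = u then 0 else b) =
        q * ∑ v ∈ S, (#(D.star v) : ℝ) + b * #(S.erase u) := by
      rw [sum_add_distrib, ← mul_sum, sum_ite, sum_const_zero, zero_add, filter_ne', sum_const,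
        nsmul_eq_mul, mul_comm b]
    exact absurd (hdom.sum_degree_le hD hz hH hl₀ hl₁ ⟨w, hwS⟩ hle) (hsum ▸ hlower).not_ge

theorem IsDominated.exists_isBase_degree_le_of_independent [Fintype V] {u : V} {a q l : ℝ}
    (hdom : D.IsDominated z u a q l) (hz : D.IsFracBase m z) (ha : 0 ≤ a) (hl₀ : 0 ≤ l) {X : Set V}
    (hX : ∀ e, D.tail e ∈ X → D.head e ∉ X) :
    ∃ H, D.IsBase m H ∧ (∀ v ∈ X, (D.degree H v : ℤ) ≤ ⌈q * #(D.star v) + a⌉) ∧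
      (D.degree H u : ℤ) ≤ ⌊q * #(D.star u)⌋ := by
  have hstar (v : V) : ∑ e ∈ D.star v, z e ≤ a * #(({v} : Finset V).erase u) +
      q * #(D.star v) := by
    have := hdom {v}
    rw [touching_singleton, sum_singleton] at this
    exact this.trans (sub_le_self _ (mul_nonneg hl₀ (Nat.cast_nonneg _)))
  have hstar_le (v : V) : ∑ e ∈ D.star v, z e ≤ ⌈q * #(D.star v) + a⌉ := by
    have hcard : (#(({v} : Finset V).erase u) : ℝ) ≤ 1 := by
      exact_mod_cast (card_le_card (erase_subset u {v})).trans_eq (card_singleton v)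
    linarith [hstar v, mul_le_mul_of_nonneg_left hcard ha, Int.le_ceil (q * #(D.star v) + a)]
  obtain ⟨H, hH, hHX, hHu⟩ := hz.exists_isBase_degree_le hX _ (fun v _ => hstar_le v) u
  refine ⟨H, hH, hHX, Int.le_floor.2 ?_⟩
  simpa using hHu.trans (hstar u)

/-! ### Trees -/

/-- The edges with exactly one end in `S`. -/
def crossing (D : OrientedMultigraph V E) (S : Finset V) : Finset E :=
  {e | D.tail e ∈ S ↔ D.head e ∉ S}

@[simp] lemma mem_crossing {S : Finset V} :
    e ∈ D.crossing S ↔ (D.tail e ∈ S ↔ D.head e ∉ S) := by simp [crossing]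

lemma isTight_one_pair (hH : D.IsSparse 1 (charVec H)) (he : e ∈ H) :
    D.IsTight 1 (charVec H) {D.tail e, D.head e} := by
  refine ⟨insert_nonempty _ _, (hH _ (insert_nonempty _ _)).antisymm ?_⟩
  have hcard : (#{D.tail e, D.head e} : ℝ) ≤ 2 := by exact_mod_cast card_le_two
  have hle := single_le_sum (fun f _ => charVec_nonneg H f)
    (show e ∈ D.inside {D.tail e, D.head e} by simp)
  rw [charVec_of_mem he] at hle
  push_cast
  linarith

lemma exists_isBase_one_of_crossing [Fintype V] [Nonempty V] {T : Finset E}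
    (hT : ∀ A : Finset V, A.Nonempty → A ≠ univ → ∃ e ∈ T, e ∈ D.crossing A) :
    ∃ H ⊆ T, D.IsBase 1 H := by
  classical
  obtain ⟨H, hHT, hH, hmax⟩ := D.exists_maximal_isSparse 1 T
  have htight : ∀ e ∈ T, ∃ B, D.IsTight 1 (charVec H) B ∧ e ∈ D.inside B := fun e he => by
    by_cases heH : e ∈ H
    exacts [⟨_, isTight_one_pair hH heH, by simp⟩, hmax e he heH]
  obtain ⟨v⟩ := ‹Nonempty V›
  obtain ⟨A, -, hA⟩ := ({A | D.IsTight 1 (charVec H) A} : Finset _).exists_le_maximal (a := {v})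
    (by simpa using hH.isTight_singleton (charVec_nonneg H) v)
  have hA₁ : D.IsTight 1 (charVec H) A := by simpa using hA.1
  suffices hAu : A = univ from
    ⟨H, hHT, charVec_nonneg H, charVec_le_one H, hH, hAu ▸ hA₁⟩
  by_contra hAu
  obtain ⟨e, heT, heA⟩ := hT A hA₁.1 hAu
  obtain ⟨B, hB, heB⟩ := htight e heT
  rw [mem_inside] at heB
  rw [mem_crossing] at heA
  have hAB : (A ∩ B).Nonempty := by
    by_cases ht : D.tail e ∈ A
    exacts [⟨_, mem_inter.2 ⟨ht, heB.1⟩⟩, ⟨_, mem_inter.2 ⟨of_not_not (mt heA.2 ht), heB.2⟩⟩]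
  have hBA : A ∪ B ⊆ A :=
    hA.2 (by simpa using hA₁.union hH (charVec_nonneg H) hB hAB) subset_union_left
  have hsub := union_subset_right hBA
  exact heA.1 (hsub heB.1) (hsub heB.2)

lemma IsBase.exists_mem_crossing [Fintype V] (hH : D.IsBase 1 H) (hA : A.Nonempty)
    (hA' : A ≠ univ) : ∃ e ∈ H, e ∈ D.crossing A := by
  by_contra! hcross
  have hsides : ∑ e, charVec H e =
      ∑ e ∈ D.inside A, charVec H e + ∑ e ∈ D.inside Aᶜ, charVec H e := by
    classical
    rw [← sum_union (disjoint_left.2 fun e h h' => by simp_all)]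
    refine (sum_subset (subset_univ _) fun e _ he => charVec_of_notMem fun heH => ?_).symm
    have := hcross e heH
    simp only [mem_union, mem_inside, mem_compl, mem_crossing] at he this
    tauto
  have hcard : (#A : ℝ) + #Aᶜ = #(univ : Finset V) := by exact_mod_cast card_add_card_compl A
  have htight := hH.isTight_univ.2
  have hle := hH.isSparse A hA
  have hle' := hH.isSparse Aᶜ (by simpa [nonempty_iff_ne_empty] using hA')
  rw [inside_univ] at htight
  push_cast at htight hle hle'
  linarith

lemma IsSparse.card_lt (hH : D.IsSparse 1 (charVec H)) (hKH : K ⊆ H) (hA : A.Nonempty)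
    (hKA : K ⊆ D.inside A) : #K < #A := by
  classical
  have hle := hH A hA
  rw [sum_charVec] at hle
  have hcard : (#K : ℝ) ≤ #(H ∩ D.inside A) := by
    exact_mod_cast card_le_card (subset_inter hKH hKA)
  push_cast at hle
  exact_mod_cast show (#K : ℝ) < #A by linarith

lemma isBase_biUnion [Fintype V] [Nonempty V] [DecidableEq E] {k : ℕ} {T : Fin k → Finset E}
    (hT : ∀ i, D.IsBase 1 (T i)) (hdisj : Pairwise fun i j => Disjoint (T i) (T j)) :
    D.IsBase k (univ.biUnion T) := by
  refine ⟨charVec_nonneg _, charVec_le_one _, fun A hA => ?_, univ_nonempty, ?_⟩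
  · rw [sum_charVec_biUnion hdisj]
    simpa [mul_sub] using sum_le_sum fun i (_ : i ∈ univ) => (hT i).isSparse A hA
  · rw [sum_charVec_biUnion hdisj, sum_congr rfl fun i _ => (hT i).isTight_univ.2]
    simp [mul_sub]

lemma isDominated_smul_charVec (hD : ∀ e, D.tail e ≠ D.head e) {q : ℝ} (hq : 0 ≤ q) (H : Finset E)
    (u : V) : D.IsDominated (q • charVec H) u 0 q q := fun S => by
  have hle : ∑ e ∈ D.touching S, charVec H e ≤ #(D.touching S) := by
    simpa using sum_le_sum fun e (_ : e ∈ D.touching S) => charVec_le_one H e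
  simp only [Pi.smul_apply, smul_eq_mul, ← mul_sum, sum_card_star hD]
  linarith [mul_le_mul_of_nonneg_left hle hq]

lemma exists_isFracBase_of_trees [Fintype V] [Nonempty V] (hD : ∀ e, D.tail e ≠ D.head e) {k : ℕ}
    (hmk : m ≤ k) {T : Fin k → Finset E} (hT : ∀ i, D.IsBase 1 (T i))
    (hdisj : Pairwise fun i j => Disjoint (T i) (T j)) (u : V) :
    ∃ z, D.IsFracBase m z ∧ D.IsDominated z u 0 (m / k) (m / k) := by
  classical
  exact ⟨_, (isBase_biUnion hT hdisj).smul_div hmk,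
    isDominated_smul_charVec hD (by positivity) _ u⟩

/-! ### Rooted arc weights -/

/-- The arcs that lead from outside `S` into `S`. -/
def entering (D : OrientedMultigraph V E) (S : Finset V) : Finset E :=
  {e | D.tail e ∉ S ∧ D.head e ∈ S}

/-- Every nonempty set of vertices avoiding the root `u` is entered by arcs of total weight at least
`r`. -/
def IsRootConnected (D : OrientedMultigraph V E) (u : V) (r : ℝ) (y : E → ℝ) : Prop :=
  ∀ A : Finset V, A.Nonempty → u ∉ A → r ≤ ∑ e ∈ D.entering A, y e

/-- The vertex sets at which root-connectivity holds with equality. -/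
def IsRootTight (D : OrientedMultigraph V E) (u : V) (r : ℝ) (y : E → ℝ) (A : Finset V) : Prop :=
  A.Nonempty ∧ u ∉ A ∧ ∑ e ∈ D.entering A, y e = r

variable {u : V} {r : ℝ} {c : E → ℝ}

@[simp] lemma mem_entering {S : Finset V} :
    e ∈ D.entering S ↔ D.tail e ∉ S ∧ D.head e ∈ S := by simp [entering]

lemma sum_entering_inter_add_sum_entering_union_le (hy : 0 ≤ y) (A B : Finset V) :
    ∑ e ∈ D.entering (A ∩ B), y e + ∑ e ∈ D.entering (A ∪ B), y e ≤
      ∑ e ∈ D.entering A, y e + ∑ e ∈ D.entering B, y e := by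
  simp only [entering, sum_filter, ← sum_add_distrib]
  refine sum_le_sum fun e _ => ?_
  have : 0 ≤ y e := hy e
  grind

lemma IsRootTight.inter (hA : D.IsRootTight u r y A) (hB : D.IsRootTight u r y B)
    (hy : 0 ≤ y) (hyr : D.IsRootConnected u r y) (hAB : (A ∩ B).Nonempty) :
    D.IsRootTight u r y (A ∩ B) := by
  have hu : u ∉ A ∩ B := fun h => hA.2.1 (mem_inter.1 h).1
  have hunion := hyr (A ∪ B) (hA.1.mono subset_union_left) (by simp [hA.2.1, hB.2.1])
  have hsubmod := sum_entering_inter_add_sum_entering_union_le (D := D) hy A B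
  rw [hA.2.2, hB.2.2] at hsubmod
  exact ⟨hAB, hu, (by linarith : _ ≤ r).antisymm (hyr _ hAB hu)⟩

lemma IsRootConnected.exists_minimal_le (hc : 0 ≤ c) (hcr : D.IsRootConnected u r c) :
    ∃ y ≤ c, Minimal (fun y => 0 ≤ y ∧ D.IsRootConnected u r y) y := by
  have hclosed : IsClosed {y | D.IsRootConnected u r y} := by
    simp only [IsRootConnected, Set.ofPred_forall]
    exact isClosed_iInter fun A => isClosed_iInter fun _ => isClosed_iInter fun _ =>
      isClosed_le continuous_const (by fun_prop)
  obtain ⟨y, ⟨⟨hy₀, hyc⟩, hy⟩, hmin⟩ := (isCompact_Icc.inter_right hclosed).exists_isMinOn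
    ⟨c, ⟨hc, le_rfl⟩, hcr⟩ (f := fun y : E → ℝ => ∑ e, y e) (by fun_prop)
  refine ⟨y, hyc, ⟨hy₀, hy⟩, fun y' ⟨hy'₀, hy'⟩ hle => ?_⟩
  have hsum : ∑ e, y e ≤ ∑ e, y' e := hmin ⟨⟨hy'₀, hle.trans hyc⟩, hy'⟩
  have heq := (sum_eq_sum_iff_of_le fun e _ => hle e).1
    ((sum_le_sum fun e _ => hle e).antisymm hsum)
  exact fun e => (heq e (mem_univ e)).ge

lemma IsRootConnected.eventually_sub_single [DecidableEq E] [Finite V] (hy : 0 ≤ y)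
    (hyr : D.IsRootConnected u r y) (he : 0 < y e)
    (hcon : ∀ A, D.IsRootTight u r y A → e ∉ D.entering A) :
    ∀ᶠ t : ℝ in 𝓝 0, 0 ≤ y - t • Pi.single e 1 ∧ D.IsRootConnected u r (y - t • Pi.single e 1) := by
  have hsum (t : ℝ) (A : Finset V) : ∑ f ∈ D.entering A, (y - t • Pi.single e 1 : E → ℝ) f =
      ∑ f ∈ D.entering A, y f - t * if e ∈ D.entering A then 1 else 0 := by
    simp [sum_sub_distrib, ← mul_sum]
  have hnonneg : ∀ᶠ t : ℝ in 𝓝 0, ∀ f, -y f + t * Pi.single (M := fun _ => ℝ) e 1 f ≤ 0 :=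
    Filter.eventually_all.2 fun f => eventually_add_mul_le (by simpa using hy f) fun hf =>
      Pi.single_eq_of_ne (by rintro rfl; linarith) 1
  have hcut : ∀ᶠ t : ℝ in 𝓝 0, ∀ A : Finset V, A.Nonempty → u ∉ A →
      -∑ f ∈ D.entering A, y f + t * (if e ∈ D.entering A then 1 else 0) ≤ -r := by
    refine Filter.eventually_all.2 fun A => ?_
    by_cases hA : A.Nonempty ∧ u ∉ A
    · exact (eventually_add_mul_le (neg_le_neg (hyr A hA.1 hA.2)) fun h => if_neg <|
        hcon A ⟨hA.1, hA.2, neg_injective h⟩).mono fun t ht _ _ => ht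
    · exact .of_forall fun t h₁ h₂ => absurd ⟨h₁, h₂⟩ hA
  filter_upwards [hnonneg, hcut] with t hnonneg hcut
  refine ⟨fun f => ?_, fun A hA hu => ?_⟩
  · simp only [Pi.zero_apply, Pi.sub_apply, Pi.smul_apply, smul_eq_mul]
    linarith [hnonneg f]
  · rw [hsum]
    linarith [hcut A hA hu]

section Minimal

variable (hy : Minimal (fun y => 0 ≤ y ∧ D.IsRootConnected u r y) y)

include hy

lemma exists_isRootTight_of_minimal [Finite V] (he : 0 < y e) :
    ∃ A, D.IsRootTight u r y A ∧ e ∈ D.entering A := by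
  classical
  by_contra! hcon
  obtain ⟨t, hfeas, ht⟩ := (((hy.prop.2.eventually_sub_single hy.prop.1 he hcon).filter_mono
    nhdsWithin_le_nhds).and (self_mem_nhdsWithin (s := Set.Ioi 0))).exists
  have ht : 0 < t := ht
  have hsingle : (0 : E → ℝ) ≤ t • Pi.single e 1 :=
    smul_nonneg ht.le (Pi.single_nonneg.2 zero_le_one)
  have hle := hy.le_of_le hfeas (sub_le_self y hsingle) e
  simp only [Pi.sub_apply, Pi.smul_apply, Pi.single_eq_same, smul_eq_mul, mul_one] at hle
  linarith

lemma sum_head_eq_root_of_minimal [Finite V] : ∑ e with D.head e = u, y e = 0 := by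
  refine sum_eq_zero fun e he => ?_
  by_contra hne
  obtain ⟨A, hA, heA⟩ := exists_isRootTight_of_minimal hy ((hy.prop.1 e).lt_of_ne' hne)
  exact hA.2.1 ((mem_filter.1 he).2 ▸ (mem_entering.1 heA).2)

/-- All arcs of positive weight with head `v` enter the least root-tight set containing `v`. -/
lemma sum_head_eq_of_minimal [Finite V] (hr : 0 < r) (hv : v ≠ u) :
    ∑ e with D.head e = v, y e = r := by
  classical
  have := Fintype.ofFinite V
  have hge : r ≤ ∑ e with D.head e = v, y e := by
    refine (hy.prop.2 {v} (singleton_nonempty v) (by simpa using hv.symm)).trans ?_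
    exact sum_le_sum_of_subset_of_nonneg (fun e he => by simpa using (mem_entering.1 he).2)
      fun e _ _ => hy.prop.1 e
  obtain ⟨e₀, he₀, hpos⟩ : ∃ e ∈ ({e | D.head e = v} : Finset E), 0 < y e :=
    exists_lt_of_sum_lt (by simpa using hr.trans_le hge)
  obtain ⟨A₀, hA₀, heA₀⟩ := exists_isRootTight_of_minimal hy hpos
  obtain ⟨T, hT, hmin⟩ := exists_min_image ({A | D.IsRootTight u r y A ∧ v ∈ A}) card
    ⟨A₀, by simpa [hA₀, ← (mem_filter.1 he₀).2] using (mem_entering.1 heA₀).2⟩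
  obtain ⟨hT, hvT⟩ := (mem_filter.1 hT).2
  have hleast : ∀ A, D.IsRootTight u r y A → v ∈ A → T ⊆ A := fun A hA hvA => by
    have hTA := hT.inter hA hy.prop.1 hy.prop.2 ⟨v, mem_inter.2 ⟨hvT, hvA⟩⟩
    exact inter_eq_left.1 (eq_of_subset_of_card_le inter_subset_left
      (hmin _ (by simpa [hTA] using ⟨hvT, hvA⟩)))
  refine le_antisymm ?_ hge
  rw [← hT.2.2, ← sum_filter_of_ne (p := fun e => 0 < y e) fun e _ hne =>
    (hy.prop.1 e).lt_of_ne' hne]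
  refine sum_le_sum_of_subset_of_nonneg (fun e he => ?_) fun e _ _ => hy.prop.1 e
  simp only [mem_filter, mem_univ, true_and] at he
  obtain ⟨A, hA, heA⟩ := exists_isRootTight_of_minimal hy he.2
  rw [mem_entering, he.1] at heA
  exact mem_entering.2 ⟨fun h => heA.1 (hleast A hA heA.2 h), he.1 ▸ hvT⟩

lemma sum_head_mem_of_minimal [Finite V] (hr : 0 < r) (S : Finset V) :
    ∑ e with D.head e ∈ S, y e = r * #(S.erase u) := by
  rw [← sum_fiberwise_of_maps_to (t := S) fun e he => (mem_filter.1 he).2]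
  have hfiber : ∀ v ∈ S, ∑ e ∈ {e | D.head e ∈ S} with D.head e = v, y e =
      ∑ e with D.head e = v, y e := fun v hv => by
    rw [filter_filter]
    exact sum_congr (filter_congr fun e _ => and_iff_right_of_imp fun h => h ▸ hv) fun _ _ => rfl
  rw [sum_congr rfl hfiber, ← sum_erase S (sum_head_eq_root_of_minimal hy),
    sum_congr rfl fun v hv => sum_head_eq_of_minimal hy hr (ne_of_mem_erase hv), sum_const,
    nsmul_eq_mul, mul_comm]

end Minimal

/-! ### Both orientations of every edge -/

/-- The two arcs of opposite directions for every edge of `D`. -/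
def symmetrize (D : OrientedMultigraph V E) : OrientedMultigraph V (E ⊕ E) where
  tail := Sum.elim D.tail D.head
  head := Sum.elim D.head D.tail

lemma sum_inside_eq_sub_sum_entering (y : E → ℝ) (S : Finset V) :
    ∑ e ∈ D.inside S, y e = ∑ e with D.head e ∈ S, y e - ∑ e ∈ D.entering S, y e := by
  simp only [inside, entering, sum_filter, ← sum_sub_distrib]
  refine sum_congr rfl fun e _ => ?_
  grind

lemma sum_touching_eq_add_sum_entering [Fintype V] (y : E → ℝ) (S : Finset V) :
    ∑ e ∈ D.touching S, y e = ∑ e with D.head e ∈ S, y e + ∑ e ∈ D.entering Sᶜ, y e := by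
  simp only [touching, entering, mem_compl, sum_filter, ← sum_add_distrib]
  refine sum_congr rfl fun e _ => ?_
  grind

lemma sum_inside_symmetrize (y : E ⊕ E → ℝ) (S : Finset V) :
    ∑ a ∈ D.symmetrize.inside S, y a = ∑ e ∈ D.inside S, (y (.inl e) + y (.inr e)) := by
  simp only [inside, sum_filter, Fintype.sum_sum_type, ← sum_add_distrib]
  refine sum_congr rfl fun e _ => ?_
  simp only [symmetrize, Sum.elim_inl, Sum.elim_inr]
  grind

lemma sum_touching_symmetrize (y : E ⊕ E → ℝ) (S : Finset V) :
    ∑ a ∈ D.symmetrize.touching S, y a = ∑ e ∈ D.touching S, (y (.inl e) + y (.inr e)) := by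
  simp only [touching, sum_filter, Fintype.sum_sum_type, ← sum_add_distrib]
  refine sum_congr rfl fun e _ => ?_
  simp only [symmetrize, Sum.elim_inl, Sum.elim_inr]
  grind

lemma card_entering_symmetrize (D : OrientedMultigraph V E) (S : Finset V) :
    #(D.symmetrize.entering S) = #(D.crossing S) := by
  simp only [entering, crossing, card_filter, Fintype.sum_sum_type, ← sum_add_distrib]
  refine sum_congr rfl fun e _ => ?_
  simp only [symmetrize, Sum.elim_inl, Sum.elim_inr]
  grind

lemma card_crossing_compl [Fintype V] (D : OrientedMultigraph V E) (S : Finset V) :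
    #(D.crossing Sᶜ) = #(D.crossing S) := by
  congr 1
  ext
  simp only [mem_crossing, mem_compl]
  tauto

lemma card_crossing_add_card_inside (D : OrientedMultigraph V E) (S : Finset V) :
    #(D.crossing S) + #(D.inside S) = #(D.touching S) := by
  simp only [crossing, inside, touching, card_filter, ← sum_add_distrib]
  refine sum_congr rfl fun e _ => ?_
  grind

lemma isRootConnected_symmetrize [Fintype V] {k : ℕ} (hk : 0 < k)
    (hcut : ∀ A : Finset V, A.Nonempty → A ≠ univ → k ≤ #(D.crossing A)) (u : V) (r : ℝ)
    (hr : 0 ≤ r) : D.symmetrize.IsRootConnected u r fun _ => r / k := by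
  intro A hA hu
  have hcard : (k : ℝ) ≤ #(D.symmetrize.entering A) := by
    rw [card_entering_symmetrize]
    exact_mod_cast hcut A hA fun h => hu (h ▸ mem_univ u)
  calc r = k * (r / k) := by field_simp
    _ ≤ ∑ _a ∈ D.symmetrize.entering A, r / k := by
      rw [sum_const, nsmul_eq_mul]
      exact mul_le_mul_of_nonneg_right hcard (by positivity)

section Merge

variable {u : V} {y : E ⊕ E → ℝ}
  (hy : Minimal (fun y => 0 ≤ y ∧ D.symmetrize.IsRootConnected u m y) y)

include hy

lemma sum_inside_of_minimal [Finite V] (hm : 0 < m) (S : Finset V) :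
    ∑ e ∈ D.inside S, (y (.inl e) + y (.inr e)) =
      m * #(S.erase u) - ∑ a ∈ D.symmetrize.entering S, y a := by
  rw [← sum_inside_symmetrize, sum_inside_eq_sub_sum_entering,
    sum_head_mem_of_minimal hy (by exact_mod_cast hm)]

lemma isFracBase_of_minimal [Fintype V] (hm : 0 < m) (hle : ∀ e, y (.inl e) + y (.inr e) ≤ 1) :
    D.IsFracBase m fun e => y (.inl e) + y (.inr e) := by
  refine ⟨fun e => add_nonneg (hy.prop.1 _) (hy.prop.1 _), hle, fun A hA => ?_, ⟨u, mem_univ u⟩, ?_⟩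
  · rw [sum_inside_of_minimal hy hm]
    by_cases hu : u ∈ A
    · rw [cast_card_erase_of_mem hu]
      exact sub_le_self _ (sum_nonneg fun a _ => hy.prop.1 a)
    · rw [erase_eq_of_notMem hu]
      linarith [hy.prop.2 A hA hu]
  · rw [sum_inside_of_minimal hy hm, cast_card_erase_of_mem (mem_univ u)]
    simp [entering]

lemma isDominated_of_minimal [Finite V] (hD : ∀ e, D.tail e ≠ D.head e) (hm : 0 < m) {q : ℝ}
    (hyq : ∀ a, y a ≤ q) : D.IsDominated (fun e => y (.inl e) + y (.inr e)) u m q (2 * q) := by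
  have := Fintype.ofFinite V
  intro S
  have hcross : ∑ a ∈ D.symmetrize.entering Sᶜ, y a ≤ q * #(D.crossing S) := by
    rw [← card_crossing_compl, ← card_entering_symmetrize, mul_comm, ← nsmul_eq_mul]
    exact sum_le_card_nsmul _ _ _ fun a _ => hyq a
  have hcard : (#(D.crossing S) + #(D.inside S) : ℝ) = #(D.touching S) := by
    exact_mod_cast D.card_crossing_add_card_inside S
  rw [← sum_touching_symmetrize, sum_touching_eq_add_sum_entering,
    sum_head_mem_of_minimal hy (by exact_mod_cast hm), sum_card_star hD, ← hcard]
  linarith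

end Merge

/-- Edge-connectivity makes the constant weight `m / k` on both orientations root-connected; a
minimal root-connected weight below it orients a fractional base away from `u`. -/
lemma exists_isFracBase_of_le_card_crossing [Fintype V] (hD : ∀ e, D.tail e ≠ D.head e) {k : ℕ}
    (hm : 0 < m) (hmk : 2 * m ≤ k)
    (hcut : ∀ A : Finset V, A.Nonempty → A ≠ univ → k ≤ #(D.crossing A)) (u : V) :
    ∃ z, D.IsFracBase m z ∧ D.IsDominated z u m (m / k) (2 * (m / k)) := by
  have hconn := isRootConnected_symmetrize (D := D) (by omega) hcut u m m.cast_nonneg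
  obtain ⟨y, hyc, hy⟩ := hconn.exists_minimal_le fun _ => by positivity
  have hsum (e : E) : y (.inl e) + y (.inr e) ≤ 1 := by
    have hmk' : (2 * m / k : ℝ) ≤ 1 := div_le_one_of_le₀ (by exact_mod_cast hmk) k.cast_nonneg
    linarith [hyc (.inl e), hyc (.inr e), mul_div_assoc (2 : ℝ) m k]
  exact ⟨_, isFracBase_of_minimal hy hm hsum, isDominated_of_minimal hy hD hm hyc⟩

/-! ### Edge sets as spanning subgraphs -/

/-- The ends of every edge of `G`, in an arbitrary order. -/
noncomputable def ofGraph {α β : Type*} (G : Graph α β) :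
    OrientedMultigraph G.vertexSet G.edgeSet where
  tail e := ⟨_, (G.exists_isLink_of_mem_edgeSet e.2).choose_spec.choose_spec.left_mem⟩
  head e := ⟨_, (G.exists_isLink_of_mem_edgeSet e.2).choose_spec.choose_spec.right_mem⟩

/-- The spanning subgraph of `G` with edge set `F`. -/
def spanningSubgraph {α β : Type*} (G : Graph α β) (F : Finset G.edgeSet) : Graph α β :=
  G.restrict (Subtype.val '' (F : Set G.edgeSet))

section Graph

variable {α β : Type*} {G : Graph α β}

lemma isLink_tail_head (e : G.edgeSet) :
    G.IsLink e ((ofGraph G).tail e) ((ofGraph G).head e) :=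
  (G.exists_isLink_of_mem_edgeSet e.2).choose_spec.choose_spec

lemma isLink_iff_tail_head {e : G.edgeSet} {x y : G.vertexSet} :
    G.IsLink e x y ↔ (ofGraph G).tail e = x ∧ (ofGraph G).head e = y ∨
      (ofGraph G).tail e = y ∧ (ofGraph G).head e = x := by
  simp only [(isLink_tail_head e).isLink_iff, Subtype.ext_iff]

lemma tail_ne_head [G.Loopless] (e : G.edgeSet) : (ofGraph G).tail e ≠ (ofGraph G).head e :=
  fun h => (isLink_tail_head e).ne (congrArg Subtype.val h)

lemma head_notMem_of_isIndependent {X : Set α} (hX : G.IsIndependent X) (e : G.edgeSet)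
    (he : (ofGraph G).tail e ∈ (Subtype.val ⁻¹' X : Set G.vertexSet)) :
    (ofGraph G).head e ∉ (Subtype.val ⁻¹' X : Set G.vertexSet) :=
  fun he' => hX _ he _ he' (isLink_tail_head e).adj

lemma isLink_spanningSubgraph {F : Finset G.edgeSet} {e : β} {x y : α} :
    (spanningSubgraph G F).IsLink e x y ↔ ∃ f ∈ F, ↑f = e ∧ G.IsLink f x y := by
  simp only [spanningSubgraph, Graph.restrict, Set.mem_image, mem_coe]
  grind

lemma mem_edgeSet_spanningSubgraph {F : Finset G.edgeSet} {e : β} :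
    e ∈ (spanningSubgraph G F).edgeSet ↔ ∃ f ∈ F, ↑f = e := by
  simp [spanningSubgraph]

lemma isSpanningSubgraph_spanningSubgraph (F : Finset G.edgeSet) :
    (spanningSubgraph G F).IsSpanningSubgraph G :=
  ⟨Graph.restrict_le, rfl⟩

lemma spanningSubgraph_mono {F K : Finset G.edgeSet} (h : F ⊆ K) :
    (spanningSubgraph G F).IsSpanningSubgraph (spanningSubgraph G K) :=
  ⟨Graph.restrict_mono_right G (Set.image_mono (coe_subset.2 h)), rfl⟩

lemma exists_spanningSubgraph_eq [Finite G.edgeSet] {H : Graph α β}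
    (hH : H.IsSpanningSubgraph G) : ∃ F, spanningSubgraph G F = H := by
  refine ⟨(Set.toFinite {e : G.edgeSet | e.1 ∈ H.edgeSet}).toFinset,
    Graph.ext hH.vertexSet_eq.symm fun e x y => ?_⟩
  simp only [isLink_spanningSubgraph, Set.Finite.mem_toFinset, Set.mem_ofPred_eq]
  constructor
  · rintro ⟨f, hf, rfl, h⟩
    exact (hH.le.isLink_iff hf).2 h
  · exact fun h => ⟨⟨e, (hH.le.isLink_mono h).edge_mem⟩, h.edge_mem, rfl, hH.le.isLink_mono h⟩

@[simp] lemma spanningSubgraph_univ [Fintype G.edgeSet] : spanningSubgraph G univ = G := by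
  simp [spanningSubgraph]

lemma isConnected_iff_cut_nonempty : G.IsConnected ↔ G.vertexSet.Nonempty ∧
    ∀ S ⊆ G.vertexSet, S.Nonempty → S ≠ G.vertexSet → (G.cut S).Nonempty := by
  refine and_congr_right fun _ => ⟨fun h S hS ⟨x, hx⟩ hne => ?_, fun h x hx y hy => ?_⟩
  · by_contra! hcut
    refine hne (hS.antisymm fun y hy => ?_)
    induction h x (hS hx) y hy with
    | refl => exact hx
    | tail _ hbc hb =>
      obtain ⟨e, he⟩ := hbc
      by_contra hc
      exact hcut.subset ⟨_, hb he.left_mem, _, hc, he⟩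
  · by_contra hxy
    obtain ⟨e, a, ha, b, hb, he⟩ := h {z ∈ G.vertexSet | Relation.ReflTransGen G.Adj x z}
      (Set.sep_subset _ _) ⟨x, hx, .refl⟩ fun heq => hxy (heq.superset hy).2
    exact hb ⟨he.right_mem, ha.2.tail he.adj⟩

lemma vertexSet_nonempty_of_isTreeConnected {k : ℕ} (hk : 0 < k) (hG : G.IsTreeConnected k) :
    G.vertexSet.Nonempty := by
  obtain ⟨T, hT, -⟩ := hG
  exact (hT ⟨0, hk⟩).1.vertexSet_eq ▸ (hT ⟨0, hk⟩).2.1.1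

lemma exists_image_val_eq [Finite G.vertexSet] {S : Set α} (hS : S ⊆ G.vertexSet) :
    ∃ A : Finset G.vertexSet, Subtype.val '' (A : Set G.vertexSet) = S :=
  ⟨(Set.toFinite (Subtype.val ⁻¹' S)).toFinset, by simpa using hS⟩

lemma image_val_eq_vertexSet [Fintype G.vertexSet] {A : Finset G.vertexSet} :
    Subtype.val '' (A : Set G.vertexSet) = G.vertexSet ↔ A = univ := by
  rw [← coe_eq_univ, ← Subtype.val_injective.image_injective.eq_iff, Subtype.coe_image_univ]

variable [DecidableEq G.vertexSet]

lemma deg_spanningSubgraph (F : Finset G.edgeSet) (v : G.vertexSet) :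
    (spanningSubgraph G F).deg v = (ofGraph G).degree F v := by
  rw [degree, ← Set.ncard_coe_finset, ← Set.ncard_image_of_injective _ Subtype.val_injective,
    Graph.deg]
  congr 1
  ext e
  simp only [Graph.mem_incidenceSet, Graph.Inc, isLink_spanningSubgraph, coe_filter,
    Set.mem_image, Set.mem_ofPred_eq]
  constructor
  · rintro ⟨y, f, hf, rfl, h⟩
    lift y to G.vertexSet using h.right_mem
    exact ⟨f, ⟨hf, (isLink_iff_tail_head.1 h).imp And.left And.right⟩, rfl⟩
  · rintro ⟨f, ⟨hf, rfl | rfl⟩, rfl⟩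
    exacts [⟨_, f, hf, rfl, isLink_tail_head f⟩, ⟨_, f, hf, rfl, (isLink_tail_head f).symm⟩]

variable [Fintype G.edgeSet]

lemma deg_eq_card_star (v : G.vertexSet) : G.deg v = #((ofGraph G).star v) := by
  simpa [degree, star] using deg_spanningSubgraph univ v

lemma cut_spanningSubgraph (F : Finset G.edgeSet) (A : Finset G.vertexSet) :
    (spanningSubgraph G F).cut (Subtype.val '' (A : Set G.vertexSet)) =
      Subtype.val '' (F ∩ (ofGraph G).crossing A : Set G.edgeSet) := by
  ext e
  simp only [Graph.cut, isLink_spanningSubgraph, Set.mem_ofPred_eq, Set.mem_image, mem_coe,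
    Set.mem_inter_iff, mem_crossing]
  constructor
  · rintro ⟨_, ⟨x, hx, rfl⟩, y, hy, f, hf, rfl, h⟩
    lift y to G.vertexSet using h.right_mem
    have hyA : y ∉ A := fun h => hy ⟨y, h, rfl⟩
    refine ⟨f, ⟨hf, ?_⟩, rfl⟩
    rcases isLink_iff_tail_head.1 h with ⟨ht, hh⟩ | ⟨ht, hh⟩ <;> simp [ht, hh, hx, hyA]
  · rintro ⟨f, ⟨hf, hcross⟩, rfl⟩
    by_cases ht : (ofGraph G).tail f ∈ A
    · exact ⟨_, ⟨_, ht, rfl⟩, _, by simpa using hcross.1 ht, f, hf, rfl, isLink_tail_head f⟩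
    · exact ⟨_, ⟨_, of_not_not (mt hcross.2 ht), rfl⟩, _, by simpa using ht, f, hf, rfl,
        (isLink_tail_head f).symm⟩

lemma not_hasCycle_spanningSubgraph {F : Finset G.edgeSet}
    (hF : (ofGraph G).IsSparse 1 (charVec F)) : ¬ (spanningSubgraph G F).HasCycle := by
  classical
  rintro ⟨n, v, e, hv, he, hlink⟩
  choose f hfF hfe hlink using fun i => isLink_spanningSubgraph.1 (hlink i)
  lift v to Fin (n + 1) → G.vertexSet using fun i => (hlink i).left_mem
  have hf : Function.Injective f := fun i j h => he (by rw [← hfe, ← hfe, h])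
  have hlt := hF.card_lt (K := univ.image f) (A := univ.image v)
    (by simpa [subset_iff] using hfF) (univ_nonempty.image v) fun g hg => ?_
  · rw [card_image_of_injective _ hf, card_image_of_injective _ hv.of_comp] at hlt
    exact hlt.false
  · obtain ⟨i, -, rfl⟩ := mem_image.1 hg
    rcases isLink_iff_tail_head.1 (hlink i) with ⟨ht, hh⟩ | ⟨ht, hh⟩ <;> simp [ht, hh]

variable [Fintype G.vertexSet]

lemma exists_mem_crossing_of_isConnected {F : Finset G.edgeSet}
    (hF : (spanningSubgraph G F).IsConnected) {A : Finset G.vertexSet} (hA : A.Nonempty)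
    (hA' : A ≠ univ) : ∃ e ∈ F, e ∈ (ofGraph G).crossing A := by
  have hcut := (isConnected_iff_cut_nonempty.1 hF).2 (Subtype.val '' (A : Set G.vertexSet))
    (Subtype.coe_image_subset _ _) (hA.to_set.image _) (mt image_val_eq_vertexSet.1 hA')
  rw [cut_spanningSubgraph] at hcut
  obtain ⟨-, e, ⟨heF, he⟩, -⟩ := hcut
  exact ⟨e, heF, he⟩

lemma IsBase.isConnected_spanningSubgraph {F : Finset G.edgeSet} (hF : (ofGraph G).IsBase 1 F) :
    (spanningSubgraph G F).IsConnected := by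
  obtain ⟨v, -⟩ := hF.isTight_univ.1
  refine isConnected_iff_cut_nonempty.2 ⟨⟨v, v.2⟩, fun S hS hne hne' => ?_⟩
  obtain ⟨A, rfl⟩ := exists_image_val_eq (G := G) hS
  rw [cut_spanningSubgraph]
  obtain ⟨e, heF, he⟩ := hF.exists_mem_crossing (A := A) (by simpa using hne)
    (mt image_val_eq_vertexSet.2 hne')
  exact ⟨e, e, ⟨heF, he⟩, rfl⟩

lemma IsBase.isTree_spanningSubgraph {F : Finset G.edgeSet} (hF : (ofGraph G).IsBase 1 F) :
    (spanningSubgraph G F).IsTree :=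
  ⟨hF.isConnected_spanningSubgraph, not_hasCycle_spanningSubgraph hF.isSparse⟩

lemma IsBase.isTreeConnected_spanningSubgraph {m : ℕ} {F : Finset G.edgeSet}
    (hF : (ofGraph G).IsBase m F) :
    (spanningSubgraph G F).IsTreeConnected m := by
  obtain ⟨T, hT, hdisj⟩ := hF.exists_disjoint_trees
  refine ⟨fun i => spanningSubgraph G (T i), fun i => ⟨spanningSubgraph_mono (hT i).1,
    (hT i).2.isTree_spanningSubgraph⟩, fun i j hij => Set.disjoint_left.2 fun e hi hj => ?_⟩
  obtain ⟨f, hfi, rfl⟩ := mem_edgeSet_spanningSubgraph.1 hi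
  obtain ⟨g, hgj, hgf⟩ := mem_edgeSet_spanningSubgraph.1 hj
  exact disjoint_left.1 (hdisj hij) hfi (Subtype.ext hgf ▸ hgj)

lemma exists_disjoint_trees_of_isTreeConnected {k : ℕ} (hG : G.IsTreeConnected k)
    (hV : G.vertexSet.Nonempty) :
    ∃ T : Fin k → Finset G.edgeSet, (∀ i, (ofGraph G).IsBase 1 (T i)) ∧
      Pairwise fun i j => Disjoint (T i) (T j) := by
  have := hV.to_subtype
  obtain ⟨T, hT, hdisj⟩ := hG
  choose F hF using fun i => exists_spanningSubgraph_eq (hT i).1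
  choose B hBF hB using fun i => exists_isBase_one_of_crossing (D := ofGraph G)
    fun A => exists_mem_crossing_of_isConnected (A := A) ((hF i).symm ▸ (hT i).2.1)
  refine ⟨B, hB, fun i j hij => disjoint_left.2 fun e hi hj => ?_⟩
  have hmem : ∀ i, e ∈ B i → e.1 ∈ (T i).edgeSet := fun i he =>
    hF i ▸ mem_edgeSet_spanningSubgraph.2 ⟨e, hBF i he, rfl⟩
  exact Set.disjoint_left.1 (hdisj i j hij) (hmem i hi) (hmem j hj)

lemma le_card_crossing_of_isEdgeConnected {k : ℕ} (hG : G.IsEdgeConnected k)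
    {A : Finset G.vertexSet} (hA : A.Nonempty) (hA' : A ≠ univ) :
    k ≤ #((ofGraph G).crossing A) := by
  refine (hG.2 (Subtype.val '' (A : Set G.vertexSet)) (Subtype.coe_image_subset _ _)
    (hA.to_set.image _) (mt image_val_eq_vertexSet.1 hA')).trans_eq ?_
  have hcut := cut_spanningSubgraph (univ : Finset G.edgeSet) A
  rw [spanningSubgraph_univ, coe_univ, Set.univ_inter] at hcut
  rw [hcut, Set.ncard_image_of_injective _ Subtype.val_injective, Set.ncard_coe_finset]

/-! ### The four degree bounds -/

section Cases

variable {m k : ℕ}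

lemma ceil_eq_ceil_add_natCast {r : ℝ} {s : ℚ} {n : ℕ} (h : r = s + n) : ⌈r⌉ = ⌈s⌉ + n := by
  rw [h, Int.ceil_add_natCast, Rat.ceil_cast]

lemma floor_mul_natCast_eq (m k d : ℕ) : ⌊(m / k * d : ℝ)⌋ = ⌊(m / k * d : ℚ)⌋ := by
  rw [← Rat.floor_cast (α := ℝ)]
  push_cast
  rfl

variable [G.Loopless]

lemma exists_isFracBase_of_isEdgeConnected (hG : G.IsEdgeConnected k) (hm : 0 < m)
    (hmk : 2 * m ≤ k) (u : G.vertexSet) : ∃ z, (ofGraph G).IsFracBase m z ∧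
      (ofGraph G).IsDominated z u m (m / k) (2 * (m / k)) :=
  exists_isFracBase_of_le_card_crossing tail_ne_head hm hmk
    (fun _ => le_card_crossing_of_isEdgeConnected hG) u

lemma exists_isFracBase_of_isTreeConnected (hG : G.IsTreeConnected k) (hmk : m ≤ k)
    (u : G.vertexSet) : ∃ z, (ofGraph G).IsFracBase m z ∧
      (ofGraph G).IsDominated z u 0 (m / k) (m / k) := by
  have : Nonempty G.vertexSet := ⟨u⟩
  obtain ⟨T, hT, hdisj⟩ := exists_disjoint_trees_of_isTreeConnected hG ⟨u, u.2⟩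
  exact exists_isFracBase_of_trees tail_ne_head hmk hT hdisj u

lemma exists_isBase_of_isEdgeConnected (hG : G.IsEdgeConnected k) (hm : 0 < m)
    (hmk : 2 * m ≤ k) (u : G.vertexSet) : ∃ B, (ofGraph G).IsBase m B ∧
      (∀ v, ((ofGraph G).degree B v : ℤ) ≤ ⌈(m : ℚ) / k * (G.deg v - 2 * m)⌉ + 2 * m) ∧
      ((ofGraph G).degree B u : ℤ) ≤ ⌊(m : ℚ) / k * G.deg u⌋ := by
  obtain ⟨z, hz, hdom⟩ := exists_isFracBase_of_isEdgeConnected hG hm hmk u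
  have hle : 2 * (m / k : ℝ) ≤ 1 := by
    rw [← mul_div_assoc]
    exact div_le_one_of_le₀ (by exact_mod_cast hmk) k.cast_nonneg
  obtain ⟨B, hB, hdeg, hu⟩ := hdom.exists_isBase_degree_le tail_ne_head hm hz m.cast_nonneg
    (by positivity) hle
  refine ⟨B, hB, fun v => (hdeg v).trans_eq ?_, hu.trans_eq ?_⟩
  · rw [← deg_eq_card_star]
    exact_mod_cast ceil_eq_ceil_add_natCast (n := 2 * m) (by push_cast; ring)
  · rw [← deg_eq_card_star, floor_mul_natCast_eq]

lemma exists_isBase_of_isTreeConnected (hG : G.IsTreeConnected k) (hm : 0 < m) (hmk : m ≤ k)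
    (u : G.vertexSet) : ∃ B, (ofGraph G).IsBase m B ∧
      (∀ v, ((ofGraph G).degree B v : ℤ) ≤ ⌈(m : ℚ) / k * (G.deg v - m)⌉ + m) ∧
      ((ofGraph G).degree B u : ℤ) ≤ ⌊(m : ℚ) / k * G.deg u⌋ := by
  obtain ⟨z, hz, hdom⟩ := exists_isFracBase_of_isTreeConnected hG hmk u
  have hle : (m / k : ℝ) ≤ 1 := div_le_one_of_le₀ (by exact_mod_cast hmk) k.cast_nonneg
  obtain ⟨B, hB, hdeg, hu⟩ := hdom.exists_isBase_degree_le tail_ne_head hm hz le_rfl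
    (by positivity) hle
  refine ⟨B, hB, fun v => (hdeg v).trans_eq ?_, hu.trans_eq ?_⟩
  · rw [← deg_eq_card_star]
    exact ceil_eq_ceil_add_natCast (by push_cast; ring)
  · rw [← deg_eq_card_star, floor_mul_natCast_eq]

lemma exists_isBase_of_isEdgeConnected_of_isIndependent (hG : G.IsEdgeConnected k) (hm : 0 < m)
    (hmk : 2 * m ≤ k) {X : Set α} (hX : G.IsIndependent X) (u : G.vertexSet) :
    ∃ B, (ofGraph G).IsBase m B ∧
      (∀ v : G.vertexSet, ↑v ∈ X → ((ofGraph G).degree B v : ℤ) ≤ ⌈(m : ℚ) / k * G.deg v⌉ + m) ∧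
      ((ofGraph G).degree B u : ℤ) ≤ ⌊(m : ℚ) / k * G.deg u⌋ := by
  obtain ⟨z, hz, hdom⟩ := exists_isFracBase_of_isEdgeConnected hG hm hmk u
  obtain ⟨B, hB, hdeg, hu⟩ := hdom.exists_isBase_degree_le_of_independent hz m.cast_nonneg
    (by positivity) (head_notMem_of_isIndependent hX)
  refine ⟨B, hB, fun v hv => (hdeg v hv).trans_eq ?_, hu.trans_eq ?_⟩
  · rw [← deg_eq_card_star]
    exact ceil_eq_ceil_add_natCast (by push_cast; ring)
  · rw [← deg_eq_card_star, floor_mul_natCast_eq]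

lemma exists_isBase_of_isTreeConnected_of_isIndependent (hG : G.IsTreeConnected k)
    (hmk : m ≤ k) {X : Set α} (hX : G.IsIndependent X) (u : G.vertexSet) :
    ∃ B, (ofGraph G).IsBase m B ∧
      (∀ v : G.vertexSet, ↑v ∈ X → ((ofGraph G).degree B v : ℤ) ≤ ⌈(m : ℚ) / k * G.deg v⌉) ∧
      ((ofGraph G).degree B u : ℤ) ≤ ⌊(m : ℚ) / k * G.deg u⌋ := by
  obtain ⟨z, hz, hdom⟩ := exists_isFracBase_of_isTreeConnected hG hmk u
  obtain ⟨B, hB, hdeg, hu⟩ := hdom.exists_isBase_degree_le_of_independent hz le_rfl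
    (by positivity) (head_notMem_of_isIndependent hX)
  refine ⟨B, hB, fun v hv => (hdeg v hv).trans_eq ?_, hu.trans_eq ?_⟩
  · rw [← deg_eq_card_star]
    simpa using ceil_eq_ceil_add_natCast (n := 0) (s := m / k * G.deg v) (by push_cast; ring)
  · rw [← deg_eq_card_star, floor_mul_natCast_eq]

end Cases

lemma exists_isTreeConnected_of_forall_exists_isBase {m : ℕ} {X : Set α} (hX : X ⊆ G.vertexSet)
    (hG : G.vertexSet.Nonempty) {f g : α → ℤ} (h : ∀ u : G.vertexSet, ∃ B,
      (ofGraph G).IsBase m B ∧ (∀ v : G.vertexSet, ↑v ∈ X → ((ofGraph G).degree B v : ℤ) ≤ f v) ∧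
        ((ofGraph G).degree B u : ℤ) ≤ g u) :
    (∃ H : Graph α β, H.IsSpanningSubgraph G ∧ H.IsTreeConnected m ∧
        ∀ v ∈ X, (H.deg v : ℤ) ≤ f v) ∧
      ∀ u ∈ G.vertexSet, ∃ H : Graph α β, H.IsSpanningSubgraph G ∧ H.IsTreeConnected m ∧
        (∀ v ∈ X, (H.deg v : ℤ) ≤ f v) ∧ (H.deg u : ℤ) ≤ g u := by
  have hu : ∀ u ∈ G.vertexSet, ∃ H : Graph α β, H.IsSpanningSubgraph G ∧ H.IsTreeConnected m ∧
      (∀ v ∈ X, (H.deg v : ℤ) ≤ f v) ∧ (H.deg u : ℤ) ≤ g u := fun u hu => by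
    obtain ⟨B, hB, hf, hg⟩ := h ⟨u, hu⟩
    simp only [← deg_spanningSubgraph] at hf hg
    exact ⟨_, isSpanningSubgraph_spanningSubgraph B, hB.isTreeConnected_spanningSubgraph,
      fun v hv => hf ⟨v, hX hv⟩ hv, hg⟩
  obtain ⟨u, huG⟩ := hG
  obtain ⟨H, hHG, hH, hf, -⟩ := hu u huG
  exact ⟨⟨H, hHG, hH, hf⟩, hu⟩

end Graph

end OrientedMultigraph

open OrientedMultigraph

theorem mainTheorem4 {α β : Type*} (G : Graph α β) [G.Loopless]
    (hV : G.vertexSet.Finite) (hE : G.edgeSet.Finite)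
    (X : Set α) (hX : X ⊆ G.vertexSet) (m k : ℕ) (hm : 0 < m) (hk : 0 < k) :
    (G.IsEdgeConnected k → 2 * m ≤ k →
      (∃ H : Graph α β, H.IsSpanningSubgraph G ∧ H.IsTreeConnected m ∧
        ∀ v ∈ X, (H.deg v : ℤ) ≤ ⌈(m : ℚ) / k * ((G.deg v : ℚ) - 2 * m)⌉ + 2 * m) ∧
      (∀ u ∈ G.vertexSet, ∃ H : Graph α β, H.IsSpanningSubgraph G ∧ H.IsTreeConnected m ∧
        (∀ v ∈ X, (H.deg v : ℤ) ≤ ⌈(m : ℚ) / k * ((G.deg v : ℚ) - 2 * m)⌉ + 2 * m) ∧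
        (H.deg u : ℤ) ≤ ⌊(m : ℚ) / k * (G.deg u : ℚ)⌋)) ∧
    (G.IsTreeConnected k → m ≤ k →
      (∃ H : Graph α β, H.IsSpanningSubgraph G ∧ H.IsTreeConnected m ∧
        ∀ v ∈ X, (H.deg v : ℤ) ≤ ⌈(m : ℚ) / k * ((G.deg v : ℚ) - m)⌉ + m) ∧
      (∀ u ∈ G.vertexSet, ∃ H : Graph α β, H.IsSpanningSubgraph G ∧ H.IsTreeConnected m ∧
        (∀ v ∈ X, (H.deg v : ℤ) ≤ ⌈(m : ℚ) / k * ((G.deg v : ℚ) - m)⌉ + m) ∧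
        (H.deg u : ℤ) ≤ ⌊(m : ℚ) / k * (G.deg u : ℚ)⌋)) ∧
    (G.IsEdgeConnected k → 2 * m ≤ k → G.IsIndependent X →
      (∃ H : Graph α β, H.IsSpanningSubgraph G ∧ H.IsTreeConnected m ∧
        ∀ v ∈ X, (H.deg v : ℤ) ≤ ⌈(m : ℚ) / k * (G.deg v : ℚ)⌉ + m) ∧
      (∀ u ∈ G.vertexSet, ∃ H : Graph α β, H.IsSpanningSubgraph G ∧ H.IsTreeConnected m ∧
        (∀ v ∈ X, (H.deg v : ℤ) ≤ ⌈(m : ℚ) / k * (G.deg v : ℚ)⌉ + m) ∧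
        (H.deg u : ℤ) ≤ ⌊(m : ℚ) / k * (G.deg u : ℚ)⌋)) ∧
    (G.IsTreeConnected k → m ≤ k → G.IsIndependent X →
      (∃ H : Graph α β, H.IsSpanningSubgraph G ∧ H.IsTreeConnected m ∧
        ∀ v ∈ X, (H.deg v : ℤ) ≤ ⌈(m : ℚ) / k * (G.deg v : ℚ)⌉) ∧
      (∀ u ∈ G.vertexSet, ∃ H : Graph α β, H.IsSpanningSubgraph G ∧ H.IsTreeConnected m ∧
        (∀ v ∈ X, (H.deg v : ℤ) ≤ ⌈(m : ℚ) / k * (G.deg v : ℚ)⌉) ∧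
        (H.deg u : ℤ) ≤ ⌊(m : ℚ) / k * (G.deg u : ℚ)⌋)) := by
  classical
  have := hV.fintype
  have := hE.fintype
  refine ⟨fun hG hmk => ?_, fun hG hmk => ?_, fun hG hmk hXi => ?_, fun hG hmk hXi => ?_⟩ <;>
    refine exists_isTreeConnected_of_forall_exists_isBase hX ?_ fun u => ?_
  · exact hG.1
  · obtain ⟨B, hB, hdeg, hu⟩ := exists_isBase_of_isEdgeConnected hG hm hmk u
    exact ⟨B, hB, fun v _ => hdeg v, hu⟩
  · exact vertexSet_nonempty_of_isTreeConnected hk hG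
  · obtain ⟨B, hB, hdeg, hu⟩ := exists_isBase_of_isTreeConnected hG hm hmk u
    exact ⟨B, hB, fun v _ => hdeg v, hu⟩
  · exact hG.1
  · exact exists_isBase_of_isEdgeConnected_of_isIndependent hG hm hmk hXi u
  · exact vertexSet_nonempty_of_isTreeConnected hk hG
  · exact exists_isBase_of_isTreeConnected_of_isIndependent hG hmk hXi u
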